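/- Let $m,n\ge 2$. Let $L^\infty(\mathbb M_{m,n})$ be the space of essentially bounded $m\times n$ matrix functions on the unit circle $\mathbb T$, with norm $\operatorname{ess\,sup}_{\zeta}\|\Phi(\zeta)\|$ (operator norm $\mathbb C^n\to\mathbb C^m$), and $H^\infty(\mathbb M_{m,n})$ the subspace of bounded analytic functions (vanishing Fourier coefficients of negative order). Let $H^2(\mathbb C^n)\subset L^2(\mathbb C^n)$ be the Hardy space, $H^2_-(\mathbb C^n)=L^2(\mathbb C^n)\ominus H^2(\mathbb C^n)$, and let $\mathbb P_\pm$ be the orthogonal projections onto $H^2$ and $H^2_-$. For $\Phi\in L^\infty(\mathbb M_{m,n})$ let $H_\Phi f=\mathbb P_-(\Phi f)$ and $T_\Phi f=\mathbb P_+(\Phi f)$, $f\in H^2(\mathbb C^n)$, be the Hankel and Toeplitz operators, and put $$\mathcal M_\Phi=\{f\in H^2(\mathbb C^n):\ \|H_\Phi f\|_2=\|H_\Phi\|\,\|f\|_2\}.$$ The essential norm $\|T\|_{\rm e}$ of an operator is its distance to the compact operators, and $\operatorname{ind}T=\dim\ker T-\dim\operatorname{coker}T$ for a Fredholm operator $T$.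 The function $\Phi$ is called badly approximable if $\|\Phi\|_{L^\infty}=\operatorname{dist}_{L^\infty}(\Phi,H^\infty)$. A function $\Theta\in H^\infty(\mathbb M_{m,n})$ is inner if $\Theta^*\Theta=I_n$ a.e., outer if $\Theta H^2(\mathbb C^n)$ is dense in $H^2(\mathbb C^m)$, and co-outer if $\Theta^t$ is outer. An $n\times n$ matrix function is thematic if it is unitary-valued and of the form $(\,v\ \ \overline\Theta\,)$, where $v$ ($n\times1$) and $\Theta$ ($n\times(n-1)$) are inner and co-outer. Let $G\in L^\infty(\mathbb M_{m,n})$ be badly approximable with $\|H_G\|_{\rm e}<1$ and $\|H_G\|=1$, and suppose that $$G=W^*\begin{pmatrix}u&0\\0&\Psi\end{pmatrix}V^*,$$ where $V=(\,v\ \ \overline\Theta\,)$ and $W^t=(\,w\ \ \overline\Xi\,)$ are thematic, $u$ is a unimodular function and $\Psi\in L^\infty(\mathbb M_{m-1,n-1})$. 1. If $f\in\mathcal M_G$ satisfies $\Theta^tf=0$, then $f=\xi v$ for some $\xi\in\ker T_u$. 2. If $\Psi$ is badly approximable with $\|\Psi\|_{L^\infty}=1$ and $T_u$ is Fredholm with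 $\operatorname{ind}T_u\le0$, then $\dim\mathcal M_G\le\dim\mathcal M_\Psi$. If moreover $\operatorname{ind}T_u=0$, then $\dim\mathcal M_G=\dim\mathcal M_\Psi$. -/

import Mathlib

open MeasureTheory AddCircle
open scoped ENNReal Matrix Matrix.Norms.L2Operator

noncomputable section

/-- The unit circle `𝕋`, parametrized by `t ↦ ζ = exp (2πit)`, `t ∈ ℝ/ℤ`; it carries the normalized
Lebesgue measure `haarAddCircle`, and `z ^ k` is `fourier k`. -/
abbrev Circ : Type := UnitAddCircle

/-- `L²(ℂⁿ)`. -/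
abbrev L2 (n : ℕ) : Type := Lp (EuclideanSpace ℂ (Fin n)) 2 (haarAddCircle : Measure Circ)

/-- `L^∞(𝕄_{m,n})`. Matrices carry the operator norm induced by the Euclidean norms of `ℂⁿ` and
`ℂᵐ`, so the norm of `Φ` is the essential supremum of `‖Φ(ζ)‖`. Scalar functions in `L^∞` are
identified with `1 × 1` matrix functions, and columns with `n × 1` matrix functions. -/
abbrev Linfty (m n : ℕ) : Type := Lp (Matrix (Fin m) (Fin n) ℂ) ∞ (haarAddCircle : Measure Circ)

/-- The `k`-th Fourier coefficient as a linear map on `L^p(E)`. -/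
def coeffLM (E : Type) [NormedAddCommGroup E] [NormedSpace ℂ E] [CompleteSpace E]
    (p : ℝ≥0∞) [Fact (1 ≤ p)] (k : ℤ) : Lp E p (haarAddCircle : Measure Circ) →ₗ[ℂ] E where
  toFun f := fourierCoeff (f : Circ → E) k
  map_add' f g := by
    have hi : ∀ h : Lp E p (haarAddCircle : Measure Circ),
        Integrable (fun t => fourier (-k) t • h t) haarAddCircle := fun h =>
      ((Lp.memLp h).integrable Fact.out).bdd_smul 1
        (map_continuous (fourier (-k))).aestronglyMeasurable
        (Filter.Eventually.of_forall fun t => by rw [fourier_apply]; exact (Circle.norm_coe _).le)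
    unfold fourierCoeff
    rw [← integral_add (hi f) (hi g)]
    refine integral_congr_ae ?_
    filter_upwards [Lp.coeFn_add f g] with t ht
    rw [ht, Pi.add_apply, smul_add]
  map_smul' c f := by
    unfold fourierCoeff
    rw [RingHom.id_apply, ← integral_smul]
    refine integral_congr_ae ?_
    filter_upwards [Lp.coeFn_smul c f] with t ht
    rw [ht, Pi.smul_apply, smul_comm]

/-- The functions of `L^p(E)` whose Fourier coefficients of negative order vanish. -/
def hardy (E : Type) [NormedAddCommGroup E] [NormedSpace ℂ E] [CompleteSpace E]
    (p : ℝ≥0∞) [Fact (1 ≤ p)] : Submodule ℂ (Lp E p (haarAddCircle : Measure Circ)) :=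
  ⨅ k : ℤ, ⨅ _ : k < 0, LinearMap.ker (coeffLM E p k)

theorem mem_hardy {E : Type} [NormedAddCommGroup E] [NormedSpace ℂ E] [CompleteSpace E]
    {p : ℝ≥0∞} [Fact (1 ≤ p)] {f : Lp E p (haarAddCircle : Measure Circ)} :
    f ∈ hardy E p ↔ ∀ k : ℤ, k < 0 → fourierCoeff (f : Circ → E) k = 0 := by
  simp [hardy, Submodule.mem_iInf, coeffLM]

/-- The Hardy space `H²(ℂⁿ)`. -/
abbrev H2 (n : ℕ) : Submodule ℂ (L2 n) := hardy (EuclideanSpace ℂ (Fin n)) 2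

/-- The space `H^∞(𝕄_{m,n})` of bounded analytic matrix functions. -/
abbrev Hinfty (m n : ℕ) : Submodule ℂ (Linfty m n) := hardy (Matrix (Fin m) (Fin n) ℂ) ∞

/-- The space `H²₋(ℂⁿ) = L²(ℂⁿ) ⊖ H²(ℂⁿ)`. -/
abbrev H2minus (n : ℕ) : Submodule ℂ (L2 n) := (H2 n)ᗮ

theorem coeffLM_bound (n : ℕ) (k : ℤ) (f : L2 n) :
    ‖coeffLM (EuclideanSpace ℂ (Fin n)) 2 k f‖ ≤ 1 * ‖f‖ := by
  have h1 : ‖coeffLM (EuclideanSpace ℂ (Fin n)) 2 k f‖ ≤ ∫ t, ‖f t‖ ∂haarAddCircle := by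
    refine (norm_integral_le_integral_norm _).trans (le_of_eq ?_)
    refine integral_congr_ae (Filter.Eventually.of_forall fun t => ?_)
    simp only [norm_smul, fourier_apply]
    rw [Circle.norm_coe, one_mul]
  refine h1.trans ?_
  rw [one_mul, integral_norm_eq_lintegral_enorm (Lp.aestronglyMeasurable f), Lp.norm_def,
    ← eLpNorm_one_eq_lintegral_enorm]
  exact ENNReal.toReal_mono (Lp.eLpNorm_ne_top f)
    (eLpNorm_le_eLpNorm_of_exponent_le (by norm_num) (Lp.aestronglyMeasurable f))

theorem isClosed_H2 (n : ℕ) : IsClosed (H2 n : Set (L2 n)) := by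
  have : (H2 n : Set (L2 n)) = ⋂ k : ℤ, ⋂ _ : k < 0,
      {f | (coeffLM (EuclideanSpace ℂ (Fin n)) 2 k).mkContinuous 1 (coeffLM_bound n k) f = 0} := by
    ext f
    simp [hardy]
  rw [this]
  exact isClosed_iInter fun k => isClosed_iInter fun _ =>
    isClosed_eq (ContinuousLinearMap.continuous _) continuous_const

instance instCompleteSpaceH2 (n : ℕ) : CompleteSpace (H2 n) :=
  (isClosed_H2 n).completeSpace_coe

/-- The continuous bilinear map `(A, x) ↦ A x` on `𝕄_{m,n} × ℂⁿ`. -/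
def mulVecBilin (m n : ℕ) : Matrix (Fin m) (Fin n) ℂ →L[ℂ]
    EuclideanSpace ℂ (Fin n) →L[ℂ] EuclideanSpace ℂ (Fin m) :=
  LinearMap.toContinuousLinearMap
    ((Matrix.toEuclideanLin (𝕜 := ℂ) (m := Fin m) (n := Fin n)).trans
      LinearMap.toContinuousLinearMap).toLinearMap

/-- Multiplication by `Φ ∈ L^∞(𝕄_{m,n})`, as a bounded operator `L²(ℂⁿ) → L²(ℂᵐ)`. -/
def mulOp {m n : ℕ} (Φ : Linfty m n) : L2 n →L[ℂ] L2 m :=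
  (mulVecBilin m n).holderL haarAddCircle ∞ 2 2 Φ

theorem mulOp_ae {m n : ℕ} (Φ : Linfty m n) (f : L2 n) :
    ∀ᵐ t ∂(haarAddCircle : Measure Circ), (mulOp Φ f t).ofLp = Φ t *ᵥ (f t).ofLp := by
  filter_upwards [(mulVecBilin m n).coeFn_holder (r := 2) Φ f] with t ht
  exact congrArg WithLp.ofLp ht

/-- The Hankel operator `H_Φ f = ℙ₋(Φ f)`, from `H²(ℂⁿ)` to `H²₋(ℂᵐ)`. -/
def hankel {m n : ℕ} (Φ : Linfty m n) : H2 n →L[ℂ] H2minus m :=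
  (H2minus m).orthogonalProjectionOnto ∘L mulOp Φ ∘L (H2 n).subtypeL

/-- The Toeplitz operator `T_Φ f = ℙ₊(Φ f)`, from `H²(ℂⁿ)` to `H²(ℂᵐ)`. -/
def toeplitz {m n : ℕ} (Φ : Linfty m n) : H2 n →L[ℂ] H2 m :=
  (H2 m).orthogonalProjectionOnto ∘L mulOp Φ ∘L (H2 n).subtypeL

/-- The essential norm of `T`: its distance to the compact operators. -/
def essNorm {E F : Type} [NormedAddCommGroup E] [NormedSpace ℂ E] [NormedAddCommGroup F]
    [NormedSpace ℂ F] (T : E →L[ℂ] F) : ℝ :=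
  sInf {r : ℝ | ∃ K : E →L[ℂ] F, IsCompactOperator K ∧ r = ‖T - K‖}

/-- The index `dim ker T - dim coker T` of a Fredholm operator `T`. -/
def fredholmIndex {E F : Type} [NormedAddCommGroup E] [NormedSpace ℂ E] [NormedAddCommGroup F]
    [NormedSpace ℂ F] (T : E →L[ℂ] F) : ℤ :=
  (Module.finrank ℂ T.ker : ℤ) - (Module.finrank ℂ (F ⧸ T.range) : ℤ)

/-- The subspace `{f : ‖T f‖ = ‖T‖ ‖f‖}`, which consists of `0` and the maximizing vectors
of `T`. -/
def maximizing {E F : Type} [NormedAddCommGroup E] [InnerProductSpace ℂ E]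
    [NormedAddCommGroup F] [InnerProductSpace ℂ F] (T : E →L[ℂ] F) : Submodule ℂ E where
  carrier := {f | ‖T f‖ = ‖T‖ * ‖f‖}
  zero_mem' := by simp
  add_mem' := by
    intro f g hf hg
    simp only [Set.mem_ofPred_eq] at hf hg ⊢
    have h1 := parallelogram_law_with_norm ℂ (T f) (T g)
    have h2 := parallelogram_law_with_norm ℂ f g
    rw [← map_add, ← map_sub, hf, hg] at h1
    have h3 := T.le_opNorm (f + g)
    have h4 := T.le_opNorm (f - g)
    have h5 := mul_self_le_mul_self (norm_nonneg _) h4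
    refine le_antisymm h3 (abs_le_of_sq_le_sq' ?_ (norm_nonneg _)).2
    have h6 := congrArg (fun x => ‖T‖ ^ 2 * x) h2
    ring_nf at h1 h5 h6 ⊢
    linarith
  smul_mem' := by
    intro c f hf
    simp only [Set.mem_ofPred_eq] at hf ⊢
    rw [map_smul, norm_smul, norm_smul, hf]
    ring

/-- The space `𝓜_Φ = {f ∈ H²(ℂⁿ) : ‖H_Φ f‖ = ‖H_Φ‖ ‖f‖}`. -/
def maxVectors {m n : ℕ} (Φ : Linfty m n) : Submodule ℂ (H2 n) := maximizing (hankel Φ)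

/-- `F ∈ H^∞` is a best approximation of `Φ` if `‖Φ - F‖ = dist (Φ, H^∞)`. -/
def IsBestApprox {m n : ℕ} (Φ F : Linfty m n) : Prop :=
  F ∈ Hinfty m n ∧ ‖Φ - F‖ = Metric.infDist Φ (Hinfty m n : Set (Linfty m n))

/-- `Φ` is badly approximable if the zero function is a best approximation of `Φ`. -/
def IsBadlyApprox {m n : ℕ} (Φ : Linfty m n) : Prop := IsBestApprox Φ 0

/-- The scalar function `u` is unimodular. -/
def IsUnimodular (u : Linfty 1 1) : Prop :=
  ∀ᵐ t ∂(haarAddCircle : Measure Circ), ‖u t 0 0‖ = 1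

/-- The transposed matrix function `Φᵗ`. -/
def transp {m n : ℕ} (Φ : Linfty m n) : Linfty n m :=
  (LinearMap.toContinuousLinearMap
    (Matrix.transposeLinearEquiv (Fin m) (Fin n) ℂ ℂ).toLinearMap).compLp Φ

theorem transp_ae {m n : ℕ} (Φ : Linfty m n) :
    ∀ᵐ t ∂(haarAddCircle : Measure Circ), transp Φ t = (Φ t)ᵀ := by
  filter_upwards [ContinuousLinearMap.coeFn_compLp (LinearMap.toContinuousLinearMap
    (Matrix.transposeLinearEquiv (Fin m) (Fin n) ℂ ℂ).toLinearMap) Φ] with t ht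
  exact ht

/-- `Θ ∈ H^∞(𝕄_{m,n})` is inner if `Θ* Θ = I_n` a.e. -/
def IsInner {m n : ℕ} (Θ : Linfty m n) : Prop :=
  Θ ∈ Hinfty m n ∧ ∀ᵐ t ∂(haarAddCircle : Measure Circ), (Θ t)ᴴ * Θ t = 1

/-- `F ∈ H^∞(𝕄_{m,n})` is outer if `F H²(ℂⁿ)` is dense in `H²(ℂᵐ)`. -/
def IsOuter {m n : ℕ} (F : Linfty m n) : Prop :=
  F ∈ Hinfty m n ∧ closure (mulOp F '' (H2 n : Set (L2 n))) = (H2 m : Set (L2 m))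

/-- `F ∈ H^∞` is co-outer if `Fᵗ` is outer. -/
def IsCoOuter {m n : ℕ} (F : Linfty m n) : Prop := IsOuter (transp F)

/-- The function with values `(v(ζ)  conj Θ(ζ))`: the first column is `v`, and the other columns
are those of the entrywise complex conjugate of `Θ`. -/
def thematicMatrix {n k : ℕ} (v : Linfty n 1) (Θ : Linfty n k) (t : Circ) :
    Matrix (Fin n) (Fin 1 ⊕ Fin k) ℂ :=
  Matrix.fromCols (v t) ((Θ t).map star)

/-- `V = (v  conj Θ)` is thematic: it is unitary-valued, of size `n × n` with `n ≥ 2`, and the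
functions `v`, of size `n × 1`, and `Θ`, of size `n × (n - 1)`, are inner and co-outer. -/
structure IsThematic {n : ℕ} (v : Linfty n 1) (Θ : Linfty n (n - 1)) : Prop where
  two_le : 2 ≤ n
  inner_v : IsInner v
  coOuter_v : IsCoOuter v
  inner_Θ : IsInner Θ
  coOuter_Θ : IsCoOuter Θ
  unitary : ∀ᵐ t ∂(haarAddCircle : Measure Circ),
    (thematicMatrix v Θ t)ᴴ * thematicMatrix v Θ t = 1 ∧
      thematicMatrix v Θ t * (thematicMatrix v Θ t)ᴴ = 1

/-- `G = W* diag(u, Ψ) V*` a.e., where `V = (v  conj Θ)` and `Wᵗ = (w  conj Ξ)`. -/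
def Factors {m n : ℕ} (G : Linfty m n) (w : Linfty m 1) (Ξ : Linfty m (m - 1)) (u : Linfty 1 1)
    (Ψ : Linfty (m - 1) (n - 1)) (v : Linfty n 1) (Θ : Linfty n (n - 1)) : Prop :=
  ∀ᵐ t ∂(haarAddCircle : Measure Circ),
    G t = ((thematicMatrix w Ξ t)ᵀ)ᴴ * Matrix.fromBlocks (u t) 0 0 (Ψ t) * (thematicMatrix v Θ t)ᴴ

end

/-! Since `V` and `W` are unitary, `Gf` is the orthogonal sum of `w̄ u v*f` and `ΞΨΘᵗf`, so the
defect `‖f‖² - ‖Gf‖²` equals the defect of `Ψ` at `Θᵗf` (`Factors.norm_sq_sub`). If `‖Ψ‖ ≤ 1`, then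
`f` is maximizing for `H_G` exactly when `Gf ∈ H²₋` and this defect vanishes; as `ΨΘᵗf = Ξ*Gf`,
multiplication by `Θᵗ` then sends `𝓜_G` into `𝓜_Ψ`.

Part 1 computes the kernel of that map. If `Θᵗf = 0`, then `f = v(v*f)`, and co-outerness of `v` and
`w` allows `v` and `w̄` to be cancelled without leaving `H²` and `H²₋`, which puts `v*f` in `ker
T_u`. For index at most zero this kernel is trivial by Coburn's lemma, so the map is injective and
the dimension inequality follows.

For index zero `T_u` is invertible and the map is onto. Co-outerness gives only dense ranges: `g ∈
𝓜_Ψ` is a limit of `Θᵗfₖ`, and `Ψg` is a limit of `Ξ*qₖ` with `qₖ ∈ H²₋`. Multiples of `v`,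
invisible to `Θᵗ`, correct `fₖ` so that `T_G` tends to zero on the result
(`Factors.exists_norm_toeplitz_le`). The defects for `H_G` then tend to zero, and `‖H_G‖ₑ < 1`
supplies the compactness that produces a true preimage (`exists_maximizing_of_tendsto`). -/

/-! ### Fourier coefficients of scalar functions -/

theorem fourierCoeff_conj (a : Circ → ℂ) (k : ℤ) :
    fourierCoeff (fun t => star (a t)) k = star (fourierCoeff a (-k)) := by
  have h : ∀ x : ℂ, star x = (starRingEnd ℂ) x := fun _ => rfl
  simp only [fourierCoeff, h, smul_eq_mul]
  rw [← integral_conj]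
  refine integral_congr_ae (Filter.Eventually.of_forall fun t => ?_)
  simp only [map_mul, neg_neg]
  rw [fourier_neg]

theorem fourierCoeff_fourier_mul (a : Circ → ℂ) (p k : ℤ) :
    fourierCoeff (fun t => fourier p t * a t) k = fourierCoeff a (k - p) := by
  simp only [fourierCoeff, smul_eq_mul]
  refine integral_congr_ae (Filter.Eventually.of_forall fun t => ?_)
  simp only
  rw [← mul_assoc, ← fourier_add]
  congr 3
  ring

theorem memLp_fourier (p : ℝ≥0∞) (k : ℤ) :
    MemLp (fun t : Circ => (fourier k t : ℂ)) p haarAddCircle :=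
  MemLp.of_bound (map_continuous (fourier k)).aestronglyMeasurable 1
    (Filter.Eventually.of_forall fun t => by rw [fourier_apply]; exact (Circle.norm_coe _).le)

theorem hasSum_conj_fourierCoeff_mul {a b : Circ → ℂ} (ha : MemLp a 2 haarAddCircle)
    (hb : MemLp b 2 haarAddCircle) :
    HasSum (fun j => star (fourierCoeff a j) * fourierCoeff b j)
      (∫ t, star (a t) * b t ∂haarAddCircle) := by
  have h := (fourierBasis (T := 1)).hasSum_inner_mul_inner (ha.toLp a) (hb.toLp b)
  rw [L2.inner_def] at h
  have h1 : ∀ j, inner ℂ (ha.toLp a) (fourierBasis j) * inner ℂ (fourierBasis j) (hb.toLp b) =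
      star (fourierCoeff a j) * fourierCoeff b j := by
    intro j
    rw [← inner_conj_symm (ha.toLp a), ← HilbertBasis.repr_apply_apply,
      ← HilbertBasis.repr_apply_apply, fourierBasis_repr, fourierBasis_repr,
      fourierCoeff_congr_ae ha.coeFn_toLp, fourierCoeff_congr_ae hb.coeFn_toLp]
    rfl
  have h2 : ∫ t, star (a t) * b t ∂haarAddCircle =
      ∫ t, inner ℂ (ha.toLp a t) (hb.toLp b t) ∂haarAddCircle := by
    refine integral_congr_ae ?_
    filter_upwards [ha.coeFn_toLp, hb.coeFn_toLp] with t h3 h4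
    rw [h3, h4, mul_comm]
    rfl
  rw [h2]
  exact (funext h1 : _ = _) ▸ h

/-- The Fourier coefficients of a product are given by the convolution. -/
theorem hasSum_fourierCoeff_mul {a b : Circ → ℂ} (ha : MemLp a 2 haarAddCircle)
    (hb : MemLp b 2 haarAddCircle) (k : ℤ) :
    HasSum (fun j => fourierCoeff a (k - j) * fourierCoeff b j)
      (fourierCoeff (fun t => a t * b t) k) := by
  -- Parseval is applied to `zᵏā`, whose `j`-th coefficient is the conjugate of the coefficient of
  -- `a` at `k - j`.
  have hc : MemLp (fun t => fourier k t * star (a t)) 2 haarAddCircle :=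
    (ha.star).mul (memLp_fourier ∞ k)
  have h := hasSum_conj_fourierCoeff_mul hc hb
  convert h using 1
  · funext j
    rw [fourierCoeff_fourier_mul, fourierCoeff_conj, star_star, neg_sub]
  · refine integral_congr_ae (Filter.Eventually.of_forall fun t => ?_)
    simp only [star_mul', star_star, smul_eq_mul]
    rw [fourier_neg]
    simp [mul_assoc]

theorem fourierCoeff_mul_eq_zero {a b : Circ → ℂ} (ha : MemLp a 2 haarAddCircle)
    (hb : MemLp b 2 haarAddCircle) {k : ℤ}
    (h : ∀ j, fourierCoeff a (k - j) = 0 ∨ fourierCoeff b j = 0) :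
    fourierCoeff (fun t => a t * b t) k = 0 := by
  refine (hasSum_fourierCoeff_mul ha hb k).unique ?_
  convert hasSum_zero using 2 with j
  exact mul_eq_zero.2 (h j)

/-! ### Components of vector and matrix functions -/

theorem clm_fourierCoeff {E : Type} [NormedAddCommGroup E] [NormedSpace ℂ E] [CompleteSpace E]
    {p : ℝ≥0∞} [Fact (1 ≤ p)] (L : E →L[ℂ] ℂ) (f : Lp E p (haarAddCircle : Measure Circ)) (k : ℤ) :
    L (fourierCoeff (f : Circ → E) k) = fourierCoeff (fun t => L (f t)) k := by
  unfold fourierCoeff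
  rw [← L.integral_comp_comm]
  · simp only [map_smul]
  · exact ((Lp.memLp f).integrable Fact.out).bdd_smul 1
      (map_continuous (fourier (-k))).aestronglyMeasurable
      (Filter.Eventually.of_forall fun t => by rw [fourier_apply]; exact (Circle.norm_coe _).le)

theorem fourierCoeff_apply {n : ℕ} (f : L2 n) (k : ℤ) (i : Fin n) :
    fourierCoeff (f : Circ → EuclideanSpace ℂ (Fin n)) k i = fourierCoeff (fun t => f t i) k :=
  clm_fourierCoeff (EuclideanSpace.proj i) f k

theorem fourierCoeff_entry {m n : ℕ} (Φ : Linfty m n) (k : ℤ) (i : Fin m) (j : Fin n) :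
    fourierCoeff (Φ : Circ → Matrix (Fin m) (Fin n) ℂ) k i j = fourierCoeff (fun t => Φ t i j) k :=
  clm_fourierCoeff (LinearMap.toContinuousLinearMap (Matrix.entryLinearMap ℂ ℂ i j)) Φ k

theorem memLp_apply {n : ℕ} (f : L2 n) (i : Fin n) :
    MemLp (fun t => f t i) 2 (haarAddCircle : Measure Circ) :=
  (EuclideanSpace.proj (𝕜 := ℂ) i).comp_memLp' (Lp.memLp f)

theorem memLp_entry {m n : ℕ} (Φ : Linfty m n) (i : Fin m) (j : Fin n) :
    MemLp (fun t => Φ t i j) ∞ (haarAddCircle : Measure Circ) :=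
  (LinearMap.toContinuousLinearMap (Matrix.entryLinearMap ℂ ℂ i j)).comp_memLp' (Lp.memLp Φ)

theorem mem_H2_iff {n : ℕ} {f : L2 n} :
    f ∈ H2 n ↔ ∀ i, ∀ k : ℤ, k < 0 → fourierCoeff (fun t => f t i) k = 0 := by
  rw [mem_hardy]
  constructor
  · intro h i k hk
    rw [← fourierCoeff_apply, h k hk]
    rfl
  · intro h k hk
    ext i
    rw [fourierCoeff_apply, h i k hk]
    rfl

theorem entry_coeff_of_mem_Hinfty {m n : ℕ} {Φ : Linfty m n} (h : Φ ∈ Hinfty m n) (i : Fin m)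
    (j : Fin n) (k : ℤ) (hk : k < 0) : fourierCoeff (fun t => Φ t i j) k = 0 := by
  rw [← fourierCoeff_entry, mem_hardy.1 h k hk]
  rfl

theorem inner_L2_eq_sum {n : ℕ} (f g : L2 n) :
    inner ℂ f g = ∑ i, ∫ t, star (f t i) * g t i ∂haarAddCircle := by
  rw [L2.inner_def, ← integral_finsetSum]
  · refine integral_congr_ae (Filter.Eventually.of_forall fun t => ?_)
    simp only [PiLp.inner_apply]
    exact Finset.sum_congr rfl fun i _ => mul_comm _ _
  · intro i _
    exact (memLp_apply f i).star.integrable_mul (memLp_apply g i)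

theorem memLp_monomialVec {n : ℕ} (k : ℤ) (i : Fin n) :
    MemLp (fun t : Circ => (fourier k t : ℂ) • EuclideanSpace.single i (1 : ℂ)) 2 haarAddCircle :=
  (memLp_const (p := 2) (EuclideanSpace.single i (1 : ℂ))).smul (memLp_fourier ∞ k)

/-- The function `ζ ↦ ζᵏ eᵢ`. -/
noncomputable def monomialVec {n : ℕ} (k : ℤ) (i : Fin n) : L2 n :=
  (memLp_monomialVec k i).toLp _

theorem monomialVec_ae {n : ℕ} (k : ℤ) (i j : Fin n) :
    ∀ᵐ t ∂(haarAddCircle : Measure Circ),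
      monomialVec k i t j = if j = i then (fourier k t : ℂ) else 0 := by
  filter_upwards [(memLp_monomialVec k i).coeFn_toLp] with t ht
  rw [monomialVec, ht]
  by_cases h : j = i <;> simp [h]

theorem fourierCoeff_monomialVec {n : ℕ} (k l : ℤ) (i j : Fin n) :
    fourierCoeff (fun t => monomialVec k i t j) l = if j = i ∧ l = k then 1 else 0 := by
  rw [fourierCoeff_congr_ae (monomialVec_ae k i j)]
  by_cases h : j = i
  · simp only [h, if_true, true_and]
    have := congrFun (fourierCoeff_fourier (T := 1) k) l
    rw [Pi.single_apply] at this
    exact this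
  · simp [h, fourierCoeff]

theorem inner_monomialVec {n : ℕ} (k : ℤ) (i : Fin n) (f : L2 n) :
    inner ℂ (monomialVec k i) f = fourierCoeff (fun t => f t i) k := by
  have h : ∀ j, ∫ t, star (monomialVec k i t j) * f t j ∂haarAddCircle =
      if j = i then fourierCoeff (fun t => f t i) k else 0 := by
    intro j
    split_ifs with hj
    · subst hj
      refine integral_congr_ae ?_
      filter_upwards [monomialVec_ae k j j] with t ht
      rw [ht, if_pos rfl, smul_eq_mul, fourier_neg]
      rfl
    · rw [← integral_zero Circ ℂ (μ := haarAddCircle)]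
      refine integral_congr_ae ?_
      filter_upwards [monomialVec_ae k i j] with t ht
      rw [ht, if_neg hj, star_zero, zero_mul]
  rw [inner_L2_eq_sum, Finset.sum_congr rfl fun j _ => h j]
  simp

theorem monomialVec_mem_H2 {n : ℕ} {k : ℤ} (hk : 0 ≤ k) (i : Fin n) : monomialVec k i ∈ H2 n := by
  rw [mem_H2_iff]
  intro j l hl
  rw [fourierCoeff_monomialVec, if_neg]
  rintro ⟨-, rfl⟩
  omega

/-- One direction tests against the monomials `zᵏeᵢ`, `k ≥ 0`; the other is Parseval, where every
term has a vanishing factor. -/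
theorem mem_H2minus_iff {n : ℕ} {f : L2 n} :
    f ∈ H2minus n ↔ ∀ i, ∀ k : ℤ, 0 ≤ k → fourierCoeff (fun t => f t i) k = 0 := by
  rw [Submodule.mem_orthogonal]
  constructor
  · intro h i k hk
    rw [← inner_monomialVec]
    exact h _ (monomialVec_mem_H2 hk i)
  · intro h g hg
    rw [inner_L2_eq_sum]
    refine Finset.sum_eq_zero fun i _ => ?_
    refine (hasSum_conj_fourierCoeff_mul (memLp_apply g i) (memLp_apply f i)).unique ?_
    convert hasSum_zero using 2 with j
    rcases lt_or_ge j 0 with hj | hj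
    · rw [mem_H2_iff.1 hg i j hj, star_zero, zero_mul]
    · rw [h i j hj, mul_zero]

/-- A function in `L²` all of whose Fourier coefficients vanish is zero. -/
theorem eq_zero_of_fourierCoeff {n : ℕ} {f : L2 n}
    (h : ∀ i, ∀ k : ℤ, fourierCoeff (fun t => f t i) k = 0) : f = 0 := by
  have h1 : f ∈ H2 n := mem_H2_iff.2 fun i k _ => h i k
  have h2 : f ∈ H2minus n := mem_H2minus_iff.2 fun i k _ => h i k
  exact inner_self_eq_zero.1 ((Submodule.mem_orthogonal _ _).1 h2 f h1)

/-! ### Multiplication operators -/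

theorem mulOp_apply_ae {m n : ℕ} (Φ : Linfty m n) (f : L2 n) :
    ∀ᵐ t ∂(haarAddCircle : Measure Circ), ∀ i, mulOp Φ f t i = ∑ j, Φ t i j * f t j := by
  filter_upwards [mulOp_ae Φ f] with t ht i
  rw [ht]
  rfl

theorem fourierCoeff_finset_sum {ι : Type} (s : Finset ι) (a : ι → Circ → ℂ)
    (ha : ∀ i, MemLp (a i) 2 haarAddCircle) (k : ℤ) :
    fourierCoeff (fun t => ∑ i ∈ s, a i t) k = ∑ i ∈ s, fourierCoeff (a i) k := by
  have := fourierCoeff.sum (T := 1) s a fun i _ => (ha i).integrable (by norm_num)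
  rw [← Finset.sum_apply, ← this]
  congr 1
  ext t
  simp

theorem mulOp_mem_H2 {m n : ℕ} {Φ : Linfty m n} (hΦ : Φ ∈ Hinfty m n) {f : L2 n} (hf : f ∈ H2 n) :
    mulOp Φ f ∈ H2 m := by
  rw [mem_H2_iff]
  intro i k hk
  rw [fourierCoeff_congr_ae (g := fun t => ∑ j, Φ t i j * f t j)
    ((mulOp_apply_ae Φ f).mono fun t ht => ht i), fourierCoeff_finset_sum]
  · refine Finset.sum_eq_zero fun j _ => ?_
    refine fourierCoeff_mul_eq_zero ((memLp_entry Φ i j).mono_exponent le_top)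
      (memLp_apply f j) fun l => ?_
    rcases lt_or_ge l 0 with hl | hl
    · exact Or.inr (mem_H2_iff.1 hf j l hl)
    · exact Or.inl (entry_coeff_of_mem_Hinfty hΦ i j _ (by omega))
  · exact fun j => (memLp_apply f j).mul (memLp_entry Φ i j)

theorem norm_mulVecBilin_le (m n : ℕ) : ‖mulVecBilin m n‖ ≤ 1 :=
  ContinuousLinearMap.opNorm_le_bound₂ _ zero_le_one fun A x => by
    rw [one_mul]
    exact Matrix.l2_opNorm_mulVec A x

theorem norm_mulOp_apply_le {m n : ℕ} (Φ : Linfty m n) (f : L2 n) : ‖mulOp Φ f‖ ≤ ‖Φ‖ * ‖f‖ := by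
  refine ((mulVecBilin m n).norm_holder_apply_apply_le (r := 2) Φ f).trans ?_
  rw [mul_assoc]
  exact mul_le_of_le_one_left (by positivity) (norm_mulVecBilin_le m n)

/-- Entrywise complex conjugation of matrices. -/
noncomputable def conjMatrixL (m n : ℕ) :
    Matrix (Fin m) (Fin n) ℂ →SL[starRingEnd ℂ] Matrix (Fin m) (Fin n) ℂ where
  toFun A := A.map star
  map_add' A B := by ext; simp
  map_smul' c A := by ext; simp
  cont := continuous_id.matrix_map continuous_star

/-- The entrywise complex conjugate `Φ̄`. -/
noncomputable def conjM {m n : ℕ} (Φ : Linfty m n) : Linfty m n := (conjMatrixL m n).compLp Φ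

theorem conjM_ae {m n : ℕ} (Φ : Linfty m n) :
    ∀ᵐ t ∂(haarAddCircle : Measure Circ), conjM Φ t = (Φ t).map star :=
  (conjMatrixL m n).coeFn_compLp Φ

/-- The pointwise adjoint `Φ*`. -/
noncomputable def ctr {m n : ℕ} (Φ : Linfty m n) : Linfty n m := transp (conjM Φ)

theorem ctr_ae {m n : ℕ} (Φ : Linfty m n) :
    ∀ᵐ t ∂(haarAddCircle : Measure Circ), ctr Φ t = (Φ t)ᴴ := by
  filter_upwards [transp_ae (conjM Φ), conjM_ae Φ] with t h1 h2
  rw [ctr, h1, h2]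
  rfl

theorem ctr_transp {m n : ℕ} (Φ : Linfty m n) : ctr (transp Φ) = conjM Φ := by
  refine Lp.ext ?_
  filter_upwards [ctr_ae (transp Φ), conjM_ae Φ, transp_ae Φ] with t h1 h2 h3
  rw [h1, h2, h3]
  rfl

theorem ctr_conjM {m n : ℕ} (Φ : Linfty m n) : ctr (conjM Φ) = transp Φ := by
  refine Lp.ext ?_
  filter_upwards [ctr_ae (conjM Φ), conjM_ae Φ, transp_ae Φ] with t h1 h2 h3
  rw [h1, h2, h3]
  ext i j
  simp

theorem ctr_ctr {m n : ℕ} (Φ : Linfty m n) : ctr (ctr Φ) = Φ := by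
  refine Lp.ext ?_
  filter_upwards [ctr_ae (ctr Φ), ctr_ae Φ] with t h1 h2
  rw [h1, h2, Matrix.conjTranspose_conjTranspose]

theorem transp_transp {m n : ℕ} (Φ : Linfty m n) : transp (transp Φ) = Φ := by
  refine Lp.ext ?_
  filter_upwards [transp_ae (transp Φ), transp_ae Φ] with t h1 h2
  rw [h1, h2, Matrix.transpose_transpose]

theorem conjM_transp {m n : ℕ} (Φ : Linfty m n) : conjM (transp Φ) = ctr Φ := by
  rw [← ctr_transp, transp_transp]

theorem transp_mem_Hinfty {m n : ℕ} {Φ : Linfty m n} (h : Φ ∈ Hinfty m n) :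
    transp Φ ∈ Hinfty n m := by
  rw [mem_hardy]
  intro k hk
  ext i j
  rw [fourierCoeff_entry, fourierCoeff_congr_ae (g := fun t => Φ t j i)
    ((transp_ae Φ).mono fun t ht => by rw [ht]; rfl), entry_coeff_of_mem_Hinfty h j i k hk]
  rfl

/-- Multiplication by `Φ*` is the adjoint of multiplication by `Φ`. -/
theorem inner_mulOp {m n : ℕ} (Φ : Linfty m n) (f : L2 n) (g : L2 m) :
    inner ℂ (mulOp Φ f) g = inner ℂ f (mulOp (ctr Φ) g) := by
  rw [L2.inner_def, L2.inner_def]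
  refine integral_congr_ae ?_
  filter_upwards [mulOp_ae Φ f, mulOp_ae (ctr Φ) g, ctr_ae Φ] with t h1 h2 h3
  rw [EuclideanSpace.inner_eq_star_dotProduct, EuclideanSpace.inner_eq_star_dotProduct, h1, h2, h3,
    Matrix.star_mulVec, dotProduct_comm, ← Matrix.dotProduct_mulVec, dotProduct_comm]

theorem inner_mulOp_right {m n : ℕ} (Φ : Linfty m n) (f : L2 n) (g : L2 m) :
    inner ℂ g (mulOp Φ f) = inner ℂ (mulOp (ctr Φ) g) f := by
  rw [inner_mulOp, ctr_ctr]

theorem L2_ext {n : ℕ} {f g : L2 n}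
    (h : ∀ᵐ t ∂(haarAddCircle : Measure Circ), (f t).ofLp = (g t).ofLp) : f = g :=
  Lp.ext (h.mono fun _ ht => WithLp.ofLp_injective 2 ht)

/-- By duality: `Φ*` preserves analyticity, so `Φ` preserves the orthogonal complements. It is used
for `w̄` and `Ξ*`. -/
theorem mulOp_mem_H2minus {m n : ℕ} {Φ : Linfty m n} (hΦ : ctr Φ ∈ Hinfty n m) {f : L2 n}
    (hf : f ∈ H2minus n) : mulOp Φ f ∈ H2minus m := by
  rw [Submodule.mem_orthogonal] at hf ⊢
  intro g hg
  rw [inner_mulOp_right]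
  exact hf _ (mulOp_mem_H2 hΦ hg)

/-! ### The conjugation `f ↦ z̄ f̄` -/

/-- Multiplication by `zᵏ` on `L²(ℂⁿ)`. -/
noncomputable def shift {n : ℕ} (k : ℤ) : L2 n →L[ℂ] L2 n :=
  (ContinuousLinearMap.lsmul ℂ ℂ).holderL haarAddCircle ∞ 2 2 (fourierLp ∞ k)

theorem shift_ae {n : ℕ} (k : ℤ) (f : L2 n) :
    ∀ᵐ t ∂(haarAddCircle : Measure Circ), shift k f t = (fourier k t : ℂ) • f t := by
  filter_upwards [(ContinuousLinearMap.lsmul ℂ ℂ).coeFn_holder (r := 2) (fourierLp ∞ k) f,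
    coeFn_fourierLp (T := 1) ∞ k] with t h1 h2
  rw [← h2]
  exact h1

theorem fourierCoeff_shift {n : ℕ} (p : ℤ) (f : L2 n) (i : Fin n) (k : ℤ) :
    fourierCoeff (fun t => shift p f t i) k = fourierCoeff (fun t => f t i) (k - p) := by
  have h : ∀ᵐ t ∂(haarAddCircle : Measure Circ), shift p f t i = (fourier p t : ℂ) * f t i :=
    (shift_ae p f).mono fun t ht => by rw [ht]; rfl
  rw [fourierCoeff_congr_ae h, fourierCoeff_fourier_mul]

theorem mulOp_shift {m n : ℕ} (Φ : Linfty m n) (p : ℤ) (f : L2 n) :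
    mulOp Φ (shift p f) = shift p (mulOp Φ f) := by
  refine L2_ext ?_
  filter_upwards [mulOp_ae Φ (shift p f), shift_ae p f, shift_ae p (mulOp Φ f), mulOp_ae Φ f]
    with t h1 h2 h3 h4
  rw [h1, h2, h3, WithLp.ofLp_smul, WithLp.ofLp_smul, h4, Matrix.mulVec_smul]

/-- Coordinatewise complex conjugation on `ℂⁿ`. -/
noncomputable def conjVecL (n : ℕ) :
    EuclideanSpace ℂ (Fin n) →SL[starRingEnd ℂ] EuclideanSpace ℂ (Fin n) where
  toFun x := WithLp.toLp 2 (star x.ofLp)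
  map_add' x y := by ext; simp
  map_smul' c x := by ext; simp
  cont := by fun_prop

/-- The conjugation `f ↦ z̄ f̄` of `L²(ℂⁿ)`. -/
noncomputable def zbarConj (n : ℕ) : L2 n →SL[starRingEnd ℂ] L2 n :=
  (shift (-1)).comp ((conjVecL n).compLpL 2 haarAddCircle)

theorem zbarConj_ae {n : ℕ} (f : L2 n) :
    ∀ᵐ t ∂(haarAddCircle : Measure Circ),
      (zbarConj n f t).ofLp = (fourier (-1) t : ℂ) • star (f t).ofLp := by
  filter_upwards [shift_ae (-1) ((conjVecL n).compLpL 2 haarAddCircle f),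
    (conjVecL n).coeFn_compLpL f] with t h1 h2
  rw [h2] at h1
  exact congrArg WithLp.ofLp h1

theorem zbarConj_zbarConj {n : ℕ} (f : L2 n) : zbarConj n (zbarConj n f) = f := by
  refine L2_ext ?_
  filter_upwards [zbarConj_ae f, zbarConj_ae (zbarConj n f)] with t h1 h2
  rw [h2, h1, star_smul, star_star, smul_smul, fourier_neg]
  have : (fourier 1 t : ℂ) ≠ 0 := by
    rw [fourier_apply]; exact Circle.coe_ne_zero _
  have h3 : (starRingEnd ℂ) (fourier 1 t : ℂ) * star ((starRingEnd ℂ) (fourier 1 t : ℂ)) = 1 := by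
    rw [← fourier_neg, ← starRingEnd_apply, ← fourier_neg, ← fourier_add]
    simp
  rw [h3, one_smul]

theorem fourierCoeff_zbarConj {n : ℕ} (f : L2 n) (i : Fin n) (k : ℤ) :
    fourierCoeff (fun t => zbarConj n f t i) k = star (fourierCoeff (fun t => f t i) (-1 - k)) := by
  have h : ∀ᵐ t ∂(haarAddCircle : Measure Circ), zbarConj n f t i =
      (fourier (-1) t : ℂ) * star (f t i) :=
    (zbarConj_ae f).mono fun t ht => congrFun ht i
  rw [fourierCoeff_congr_ae h, fourierCoeff_fourier_mul, fourierCoeff_conj]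
  congr 2
  ring

/-- The index `k` becomes `-1 - k`, which exchanges `k ≥ 0` and `k < 0`; without the factor `z̄` the
constants would remain in `H²`. This symmetry carries density statements from `H²` to `H²₋`. -/
theorem zbarConj_mem_H2minus {n : ℕ} {f : L2 n} (hf : f ∈ H2 n) : zbarConj n f ∈ H2minus n :=
  mem_H2minus_iff.2 fun i k hk => by
    rw [fourierCoeff_zbarConj, mem_H2_iff.1 hf i _ (by omega), star_zero]

theorem zbarConj_mem_H2 {n : ℕ} {f : L2 n} (hf : f ∈ H2minus n) : zbarConj n f ∈ H2 n :=
  mem_H2_iff.2 fun i k hk => by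
    rw [fourierCoeff_zbarConj, mem_H2minus_iff.1 hf i _ (by omega), star_zero]

theorem zbarConj_mulOp {m n : ℕ} (Φ : Linfty m n) (f : L2 n) :
    zbarConj m (mulOp Φ f) = mulOp (conjM Φ) (zbarConj n f) := by
  refine L2_ext ?_
  filter_upwards [zbarConj_ae f, zbarConj_ae (mulOp Φ f), mulOp_ae Φ f,
    mulOp_ae (conjM Φ) (zbarConj n f), conjM_ae Φ] with t h1 h2 h3 h4 h5
  rw [h2, h3, h4, h1, h5, Matrix.mulVec_smul]
  congr 1
  ext i
  simp [Matrix.mulVec, dotProduct]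

/-! ### Outer functions -/

theorem IsOuter.subset_closure {m n : ℕ} {F : Linfty m n} (hF : IsOuter F) {g : L2 m}
    (hg : g ∈ H2 m) : g ∈ closure (mulOp F '' (H2 n : Set (L2 n))) := by
  rw [hF.2]
  exact hg

/-- If `F` is outer, then `F̄ H²₋` is dense in `H²₋`. -/
theorem IsOuter.subset_closure_conjM {m n : ℕ} {F : Linfty m n} (hF : IsOuter F) {g : L2 m}
    (hg : g ∈ H2minus m) : g ∈ closure (mulOp (conjM F) '' (H2minus n : Set (L2 n))) := by
  have h := mem_closure_image (zbarConj m).continuous.continuousAt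
    (hF.subset_closure (zbarConj_mem_H2 hg))
  rw [zbarConj_zbarConj] at h
  refine closure_mono ?_ h
  rintro _ ⟨_, ⟨f, hf, rfl⟩, rfl⟩
  exact ⟨zbarConj n f, zbarConj_mem_H2minus hf, (zbarConj_mulOp F f).symm⟩

theorem inner_eq_zero_of_mem_closure {n : ℕ} {S : Set (L2 n)} {x g : L2 n}
    (h : ∀ s ∈ S, inner ℂ s x = 0) (hg : g ∈ closure S) : inner ℂ g x = 0 :=
  closure_minimal (t := {s | inner ℂ s x = 0}) h
    (isClosed_eq (continuous_id.inner continuous_const) continuous_const) hg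

/-- If `Φ` is co-outer and `Φ x` is analytic, then so is `x`. -/
theorem IsCoOuter.mem_H2_of_mulOp {m n : ℕ} {Φ : Linfty m n} (hΦ : IsCoOuter Φ) {x : L2 n}
    (hx : mulOp Φ x ∈ H2 m) : x ∈ H2 n := by
  rw [← Submodule.orthogonal_orthogonal (H2 n), Submodule.mem_orthogonal]
  intro g hg
  -- It suffices to test `x` against the dense set `Φ*H²₋`, and moving `Φ*` across the inner product
  -- recovers `Φx ∈ H²`.
  refine inner_eq_zero_of_mem_closure ?_ (hΦ.subset_closure_conjM hg)
  rintro _ ⟨h, hh, rfl⟩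
  rw [inner_mulOp, ctr_conjM, transp_transp]
  exact (Submodule.mem_orthogonal' _ _).1 hh _ hx

/-- If `Φ` is co-outer and `Φ̄ x` is antianalytic, then so is `x`. -/
theorem IsCoOuter.mem_H2minus_of_mulOp {m n : ℕ} {Φ : Linfty m n} (hΦ : IsCoOuter Φ) {x : L2 n}
    (hx : mulOp (conjM Φ) x ∈ H2minus m) : x ∈ H2minus n := by
  rw [Submodule.mem_orthogonal]
  intro g hg
  refine inner_eq_zero_of_mem_closure ?_ (hΦ.subset_closure hg)
  rintro _ ⟨h, hh, rfl⟩
  rw [inner_mulOp, ctr_transp]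
  exact (Submodule.mem_orthogonal _ _).1 hx _ hh

/-! ### Contractions of essential norm less than one -/

section EssNorm

open Filter Topology

variable {E F : Type} [NormedAddCommGroup E] [InnerProductSpace ℂ E]
  [NormedAddCommGroup F] [InnerProductSpace ℂ F]

theorem exists_compact_norm_sub_lt {T : E →L[ℂ] F} {r : ℝ} (h : essNorm T < r) :
    ∃ K : E →L[ℂ] F, IsCompactOperator K ∧ ‖T - K‖ < r := by
  have hne : {r : ℝ | ∃ K : E →L[ℂ] F, IsCompactOperator K ∧ r = ‖T - K‖}.Nonempty :=
    ⟨_, 0, isCompactOperator_zero, rfl⟩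
  obtain ⟨_, ⟨K, hK, rfl⟩, hr⟩ := exists_lt_of_csInf_lt hne h
  exact ⟨K, hK, hr⟩

/-- Subtract the parallelogram laws for `T` and for the identity, and drop the defect of `x + y`,
which is nonnegative. Small defects at `x` and `y` thus force a small defect at `x - y`. -/
theorem defect_sub_le {T : E →L[ℂ] F} (hT : ‖T‖ ≤ 1) (x y : E) :
    ‖x - y‖ ^ 2 - ‖T (x - y)‖ ^ 2 ≤
      2 * (‖x‖ ^ 2 - ‖T x‖ ^ 2) + 2 * (‖y‖ ^ 2 - ‖T y‖ ^ 2) := by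
  have h1 := parallelogram_law_with_norm ℂ (T x) (T y)
  have h2 := parallelogram_law_with_norm ℂ x y
  rw [← map_add, ← map_sub] at h1
  have h3 : ‖T (x + y)‖ ^ 2 ≤ ‖x + y‖ ^ 2 :=
    pow_le_pow_left₀ (norm_nonneg _) (T.le_of_opNorm_le hT _ |>.trans_eq (one_mul _)) 2
  nlinarith

/-- A bounded sequence whose defect `‖y‖² - ‖T y‖²` tends to zero has a convergent
subsequence. -/
theorem exists_subseq_tendsto_of_defect [CompleteSpace E] {T : E →L[ℂ] F} (hT : ‖T‖ ≤ 1)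
    (hess : essNorm T < 1) {y : ℕ → E} (hy : ∀ k, ‖y k‖ ≤ 1)
    (hd : Tendsto (fun k => ‖y k‖ ^ 2 - ‖T (y k)‖ ^ 2) atTop (𝓝 0)) :
    ∃ x, ∃ φ : ℕ → ℕ, StrictMono φ ∧ Tendsto (y ∘ φ) atTop (𝓝 x) := by
  obtain ⟨K, hK, hr⟩ := exists_compact_norm_sub_lt hess
  obtain ⟨z, -, φ, hφ, hz⟩ := (hK.isCompact_closure_image_closedBall 1).tendsto_subseq
    (x := fun k => K (y k)) fun k =>
      subset_closure ⟨y k, by simpa using hy k, rfl⟩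
  suffices h : CauchySeq (y ∘ φ) by
    obtain ⟨x, hx⟩ := cauchySeq_tendsto_of_complete h
    exact ⟨x, φ, hφ, hx⟩
  set r := ‖T - K‖ with hr_def
  have hr0 : 0 ≤ r := norm_nonneg _
  have hd' := hd.comp hφ.tendsto_atTop
  rw [Metric.cauchySeq_iff']
  intro ε hε
  have hc : 0 < (1 - r) * ε ^ 2 := by
    have : 0 < 1 - r := by linarith
    positivity
  -- For a difference `d`, the two defects contribute at most `4δ` and the terms in `‖K d‖` at most
  -- `5δ`, so `(1 - r)‖d‖² < 9δ < 16δ`. The bound `‖K d‖ < 1` is there to give `‖K d‖² ≤ ‖K d‖`.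
  set δ := (1 - r) * ε ^ 2 / 16 with hδ
  have hδ0 : 0 < δ := by positivity
  have hδ1 : 0 < min δ 1 := lt_min hδ0 one_pos
  obtain ⟨N2, hN2⟩ := eventually_atTop.1 (hd'.eventually (gt_mem_nhds hδ0))
  obtain ⟨N1, hN1⟩ := (Metric.cauchySeq_iff.1 hz.cauchySeq) (min δ 1) hδ1
  refine ⟨max N1 N2, fun k hk => ?_⟩
  set N := max N1 N2
  have hK1 := hN1 k (le_trans (le_max_left _ _) hk) N (le_max_left _ _)
  have h1 := hN2 k (le_trans (le_max_right _ _) hk)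
  have h2 := hN2 N (le_max_right _ _)
  simp only [Function.comp_apply] at hK1 h1 h2 ⊢
  rw [dist_eq_norm, ← map_sub] at hK1
  rw [dist_eq_norm]
  have h3 := defect_sub_le hT (y (φ k)) (y (φ N))
  have hd2 : ‖y (φ k) - y (φ N)‖ ≤ 2 := by
    have := norm_sub_le (y (φ k)) (y (φ N))
    linarith [hy (φ k), hy (φ N)]
  set d := y (φ k) - y (φ N)
  have h4 : ‖T d‖ ≤ r * ‖d‖ + ‖K d‖ := by
    have : T d = (T - K) d + K d := by simp
    rw [this]
    exact (norm_add_le _ _).trans (add_le_add ((T - K).le_opNorm d) le_rfl)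
  have hKδ := hK1.trans_le (min_le_left _ _)
  have hK1' := hK1.trans_le (min_le_right _ _)
  have h5 : ‖T d‖ ^ 2 ≤ (r * ‖d‖ + ‖K d‖) ^ 2 := pow_le_pow_left₀ (norm_nonneg _) h4 2
  have h0 := norm_nonneg d
  have h0' := norm_nonneg (K d)
  by_contra hcon
  push Not at hcon
  have h6 : r * ‖d‖ * ‖K d‖ ≤ 2 * ‖K d‖ := by
    refine mul_le_mul_of_nonneg_right ?_ h0'
    nlinarith
  have h7 : ‖K d‖ ^ 2 ≤ ‖K d‖ := by nlinarith
  have h8 : r ^ 2 ≤ r := by nlinarith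
  have h9 : (1 - r) * ‖d‖ ^ 2 < 9 * δ := by nlinarith [sq_nonneg ‖d‖]
  have h10 : (1 - r) * ε ^ 2 ≤ (1 - r) * ‖d‖ ^ 2 :=
    mul_le_mul_of_nonneg_left (pow_le_pow_left₀ hε.le hcon 2) (by linarith)
  linarith

theorem mem_maximizing {T : E →L[ℂ] F} {x : E} : x ∈ maximizing T ↔ ‖T x‖ = ‖T‖ * ‖x‖ := Iff.rfl

theorem mem_maximizing_of_defect {T : E →L[ℂ] F} (hT : ‖T‖ = 1) {x : E}
    (h : ‖x‖ ^ 2 - ‖T x‖ ^ 2 = 0) : x ∈ maximizing T := by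
  rw [mem_maximizing, hT, one_mul]
  exact ((pow_left_inj₀ (norm_nonneg _) (norm_nonneg _) two_ne_zero).1 (sub_eq_zero.1 h)).symm

/-- An operator whose essential norm is less than its norm attains its norm. -/
theorem maximizing_ne_bot [CompleteSpace E] {T : E →L[ℂ] F} (hT : ‖T‖ = 1)
    (hess : essNorm T < 1) : maximizing T ≠ ⊥ := by
  have h : ∀ k : ℕ, ∃ y : E, ‖y‖ = 1 ∧ 1 - 1 / ((k : ℝ) + 1) < ‖T y‖ := by
    intro k
    have h1 : 1 - 1 / ((k : ℝ) + 1) < ‖T‖ := by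
      rw [hT]
      have : 0 < 1 / ((k : ℝ) + 1) := by positivity
      linarith
    by_contra hcon
    push Not at hcon
    refine absurd (T.opNorm_le_of_unit_norm (C := 1 - 1 / ((k : ℝ) + 1)) ?_ hcon) (not_le.2 h1)
    rw [sub_nonneg, div_le_one (by positivity)]
    linarith [(Nat.cast_nonneg k : (0 : ℝ) ≤ k)]
  choose y hy1 hy2 using h
  have hle : ∀ x, ‖T x‖ ≤ ‖x‖ := fun x => by simpa [hT] using T.le_opNorm x
  have hd : Tendsto (fun k => ‖y k‖ ^ 2 - ‖T (y k)‖ ^ 2) atTop (𝓝 0) := by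
    refine squeeze_zero (g := fun k : ℕ => 2 * (1 / ((k : ℝ) + 1))) (fun k => ?_) (fun k => ?_) ?_
    · exact sub_nonneg.2 (pow_le_pow_left₀ (norm_nonneg _) (hle _) 2)
    · have h1 := hle (y k)
      rw [hy1 k] at h1 ⊢
      nlinarith [hy2 k, norm_nonneg (T (y k))]
    · simpa using (tendsto_one_div_add_atTop_nhds_zero_nat (𝕜 := ℝ)).const_mul 2
  obtain ⟨x, φ, hφ, hx⟩ := exists_subseq_tendsto_of_defect hT.le hess (fun k => (hy1 k).le) hd
  have hx1 : ‖x‖ = 1 := tendsto_nhds_unique hx.norm (by simp [hy1])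
  have hx2 : ‖x‖ ^ 2 - ‖T x‖ ^ 2 = 0 :=
    tendsto_nhds_unique ((hx.norm.pow 2).sub (((T.continuous.tendsto x).comp hx).norm.pow 2))
      (hd.comp hφ.tendsto_atTop)
  intro hbot
  have h0 := mem_maximizing_of_defect hT hx2
  rw [hbot, Submodule.mem_bot] at h0
  rw [h0, norm_zero] at hx1
  exact zero_ne_one hx1

/-- Suppose that `S` is injective on the maximizing vectors of `T`, `S fₖ → g` and the defect of
`fₖ` tends to zero. Then `g` is the image under `S` of a maximizing vector. -/
theorem exists_maximizing_of_tendsto [CompleteSpace E] {D : Type} [NormedAddCommGroup D]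
    [NormedSpace ℂ D] {T : E →L[ℂ] F} (hT : ‖T‖ = 1) (hess : essNorm T < 1) (S : E →L[ℂ] D)
    (hS : ∀ x ∈ maximizing T, S x = 0 → x = 0) {f : ℕ → E} {g : D}
    (hf : Tendsto (fun k => S (f k)) atTop (𝓝 g))
    (hd : Tendsto (fun k => ‖f k‖ ^ 2 - ‖T (f k)‖ ^ 2) atTop (𝓝 0)) :
    ∃ x ∈ maximizing T, S x = g := by
  -- No bound on `‖f k‖` is known. Scaling by `1 / (1 + ‖f k‖)` gives vectors of norm `1 - s k`, so
  -- the limit of the norms also determines the limit of the scaling factors.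
  set s : ℕ → ℝ := fun k => (1 + ‖f k‖)⁻¹ with hs
  have hpos : ∀ k, 0 < 1 + ‖f k‖ := fun k => by positivity
  have hs0 : ∀ k, 0 ≤ s k := fun k => (inv_pos.2 (hpos k)).le
  have hs1 : ∀ k, s k ≤ 1 := fun k => inv_le_one_of_one_le₀ (by simp)
  have hle : ∀ x, ‖T x‖ ≤ ‖x‖ := fun x => by simpa [hT] using T.le_opNorm x
  have hnonneg : ∀ x, 0 ≤ ‖x‖ ^ 2 - ‖T x‖ ^ 2 := fun x =>
    sub_nonneg.2 (pow_le_pow_left₀ (norm_nonneg _) (hle _) 2)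
  set y : ℕ → E := fun k => (s k : ℂ) • f k with hy
  have hyn : ∀ k, ‖y k‖ = 1 - s k := by
    intro k
    have : (1 + ‖f k‖) ≠ 0 := (hpos k).ne'
    simp only [hy, norm_smul, Complex.norm_real, Real.norm_of_nonneg (hs0 k)]
    simp only [hs]
    field_simp
    ring
  have hyd : ∀ k, ‖y k‖ ^ 2 - ‖T (y k)‖ ^ 2 = s k ^ 2 * (‖f k‖ ^ 2 - ‖T (f k)‖ ^ 2) := by
    intro k
    simp only [hy, map_smul, norm_smul, Complex.norm_real, Real.norm_of_nonneg (hs0 k)]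
    ring
  have hd' : Tendsto (fun k => ‖y k‖ ^ 2 - ‖T (y k)‖ ^ 2) atTop (𝓝 0) := by
    refine squeeze_zero (fun k => hnonneg _) (fun k => ?_) hd
    rw [hyd]
    exact mul_le_of_le_one_left (hnonneg _) (pow_le_one₀ (hs0 k) (hs1 k))
  obtain ⟨x, φ, hφ, hx⟩ := exists_subseq_tendsto_of_defect hT.le hess
    (fun k => by rw [hyn]; linarith [hs0 k]) hd'
  have hx2 : ‖x‖ ^ 2 - ‖T x‖ ^ 2 = 0 :=
    tendsto_nhds_unique ((hx.norm.pow 2).sub (((T.continuous.tendsto x).comp hx).norm.pow 2))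
      (hd'.comp hφ.tendsto_atTop)
  have hxm := mem_maximizing_of_defect hT hx2
  have hslim : Tendsto (s ∘ φ) atTop (𝓝 (1 - ‖x‖)) := by
    have : s ∘ φ = fun k => 1 - ‖(y ∘ φ) k‖ := by
      funext k
      simp only [Function.comp_apply, hyn]
      ring
    rw [this]
    exact tendsto_const_nhds.sub hx.norm
  have hSx : S x = ((1 - ‖x‖ : ℝ) : ℂ) • g := by
    refine tendsto_nhds_unique ((S.continuous.tendsto x).comp hx) ?_
    have h1 := (Complex.continuous_ofReal.tendsto _).comp hslim
    refine (h1.smul (hf.comp hφ.tendsto_atTop)).congr fun k => ?_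
    simp [hy]
  -- The case `‖x‖ = 1` corresponds to `‖f k‖` tending to infinity along the subsequence. Then `S x
  -- = 0`, so `x = 0` by injectivity, a contradiction.
  have hne : ((1 - ‖x‖ : ℝ) : ℂ) ≠ 0 := by
    intro h0
    rw [h0, zero_smul] at hSx
    have h1 := hS x hxm hSx
    rw [h1] at h0
    simp at h0
  exact ⟨_, (maximizing T).smul_mem (((1 - ‖x‖ : ℝ) : ℂ)⁻¹) hxm, by
    rw [map_smul, hSx, smul_smul, inv_mul_cancel₀ hne, one_smul]⟩

end EssNorm

/-! ### Hankel and Toeplitz operators -/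

theorem coe_hankel {m n : ℕ} (Φ : Linfty m n) (f : H2 n) :
    ((hankel Φ f : H2minus m) : L2 m) = (H2minus m).starProjection (mulOp Φ f) := rfl

theorem coe_toeplitz {m n : ℕ} (Φ : Linfty m n) (f : H2 n) :
    ((toeplitz Φ f : H2 m) : L2 m) = (H2 m).starProjection (mulOp Φ f) := rfl

theorem toeplitz_add_hankel {m n : ℕ} (Φ : Linfty m n) (f : H2 n) :
    (toeplitz Φ f : L2 m) + hankel Φ f = mulOp Φ f := by
  rw [coe_hankel, coe_toeplitz]
  exact (H2 m).starProjection_add_starProjection_orthogonal _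

theorem norm_sq_toeplitz_add_hankel {m n : ℕ} (Φ : Linfty m n) (f : H2 n) :
    ‖toeplitz Φ f‖ ^ 2 + ‖hankel Φ f‖ ^ 2 = ‖mulOp Φ f‖ ^ 2 := by
  have h : inner ℂ (toeplitz Φ f : L2 m) (hankel Φ f : L2 m) = 0 :=
    (Submodule.mem_orthogonal _ _).1 (hankel Φ f).2 _ (toeplitz Φ f).2
  have h1 := norm_add_sq_eq_norm_sq_add_norm_sq_of_inner_eq_zero _ _ h
  rw [toeplitz_add_hankel] at h1
  simp only [Submodule.coe_norm] at h1 ⊢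
  linarith

theorem toeplitz_eq_zero_iff {m n : ℕ} (Φ : Linfty m n) (f : H2 n) :
    toeplitz Φ f = 0 ↔ mulOp Φ f ∈ H2minus m := by
  rw [← Submodule.coe_eq_zero, coe_toeplitz]
  exact Submodule.starProjection_apply_eq_zero_iff _

theorem norm_hankel_apply_le {m n : ℕ} (Φ : Linfty m n) (f : H2 n) :
    ‖hankel Φ f‖ ≤ ‖mulOp Φ f‖ := by
  refine (sq_le_sq₀ (norm_nonneg _) (norm_nonneg _)).1 ?_
  linarith [norm_sq_toeplitz_add_hankel Φ f, sq_nonneg ‖toeplitz Φ f‖]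

theorem norm_hankel_le {m n : ℕ} (Φ : Linfty m n) : ‖hankel Φ‖ ≤ ‖Φ‖ :=
  ContinuousLinearMap.opNorm_le_bound _ (norm_nonneg _) fun f =>
    (norm_hankel_apply_le Φ f).trans (norm_mulOp_apply_le Φ f)

/-- By Pythagoras, no norm is left for the Toeplitz part. -/
theorem mulOp_mem_H2minus_of_norm {m n : ℕ} {Φ : Linfty m n} {f : H2 n}
    (h : ‖mulOp Φ f‖ ≤ ‖hankel Φ f‖) : mulOp Φ f ∈ H2minus m := by
  rw [← toeplitz_eq_zero_iff, ← norm_eq_zero, ← sq_eq_zero_iff]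
  have := pow_le_pow_left₀ (norm_nonneg _) h 2
  nlinarith [norm_sq_toeplitz_add_hankel Φ f, sq_nonneg ‖toeplitz Φ f‖]

theorem norm_hankel_of_mem_H2minus {m n : ℕ} {Φ : Linfty m n} {f : H2 n}
    (h : mulOp Φ f ∈ H2minus m) : ‖hankel Φ f‖ = ‖mulOp Φ f‖ := by
  have h1 := norm_sq_toeplitz_add_hankel Φ f
  rw [(toeplitz_eq_zero_iff Φ f).2 h, norm_zero] at h1
  refine (pow_left_inj₀ (norm_nonneg _) (norm_nonneg _) two_ne_zero).1 ?_
  linarith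

/-! ### Unimodular symbols -/

theorem mulOp_mulOp_of_mul_eq_one {k n : ℕ} {A : Linfty n k} {B : Linfty k n}
    (h : ∀ᵐ t ∂(haarAddCircle : Measure Circ), A t * B t = 1) (f : L2 n) :
    mulOp A (mulOp B f) = f := by
  refine L2_ext ?_
  filter_upwards [h, mulOp_ae A (mulOp B f), mulOp_ae B f] with t h1 h2 h3
  rw [h2, h3, Matrix.mulVec_mulVec, h1, Matrix.one_mulVec]

theorem mulOp_mulOp_of_mul_eq_zero {k n p : ℕ} {A : Linfty p k} {B : Linfty k n}
    (h : ∀ᵐ t ∂(haarAddCircle : Measure Circ), A t * B t = 0) (f : L2 n) :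
    mulOp A (mulOp B f) = 0 := by
  refine L2_ext ?_
  filter_upwards [h, mulOp_ae A (mulOp B f), mulOp_ae B f, Lp.coeFn_zero
    (EuclideanSpace ℂ (Fin p)) 2 (haarAddCircle : Measure Circ)] with t h1 h2 h3 h4
  rw [h2, h3, Matrix.mulVec_mulVec, h1, Matrix.zero_mulVec, h4]
  rfl

theorem norm_mulOp_of_isometry {k n : ℕ} {A : Linfty n k}
    (h : ∀ᵐ t ∂(haarAddCircle : Measure Circ), (A t)ᴴ * A t = 1) (f : L2 k) :
    ‖mulOp A f‖ = ‖f‖ := by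
  have h1 : mulOp (ctr A) (mulOp A f) = f := by
    refine mulOp_mulOp_of_mul_eq_one ?_ f
    filter_upwards [h, ctr_ae A] with t h1 h2
    rw [h2, h1]
  have h2 := inner_mulOp A f (mulOp A f)
  rw [h1, inner_self_eq_norm_sq_to_K, inner_self_eq_norm_sq_to_K] at h2
  exact (pow_left_inj₀ (norm_nonneg _) (norm_nonneg _) two_ne_zero).1 (by exact_mod_cast h2)

theorem IsUnimodular.conjTranspose_mul_self {u : Linfty 1 1} (hu : IsUnimodular u) :
    ∀ᵐ t ∂(haarAddCircle : Measure Circ), (u t)ᴴ * u t = 1 := by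
  filter_upwards [hu] with t ht
  ext i j
  rw [Subsingleton.elim i 0, Subsingleton.elim j 0]
  simp only [Matrix.mul_apply, Finset.univ_unique, Finset.sum_singleton,
    Matrix.conjTranspose_apply, Matrix.one_apply_eq, Fin.default_eq_zero]
  have := Complex.conj_mul' (u t 0 0)
  rw [ht] at this
  simpa using this

theorem IsUnimodular.norm_mulOp {u : Linfty 1 1} (hu : IsUnimodular u) (f : L2 1) :
    ‖mulOp u f‖ = ‖f‖ :=
  norm_mulOp_of_isometry hu.conjTranspose_mul_self f

theorem shift_mem_H2 {n : ℕ} {p : ℤ} (hp : 0 ≤ p) {f : L2 n} (hf : f ∈ H2 n) :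
    shift p f ∈ H2 n :=
  mem_H2_iff.2 fun i k hk => by
    rw [fourierCoeff_shift, mem_H2_iff.1 hf i _ (by omega)]

/-- Coburn's lemma: if a Toeplitz operator with unimodular symbol has a nonzero kernel, then
only zero is orthogonal to its range. -/
theorem eq_zero_of_orthogonal_range_toeplitz {u : Linfty 1 1} (hu : IsUnimodular u) {ξ : H2 1}
    (hξ : ξ ≠ 0) (hker : toeplitz u ξ = 0) {h : H2 1}
    (hh : ∀ f : H2 1, inner ℂ h (toeplitz u f) = 0) : h = 0 := by
  set a := mulOp u (ξ : L2 1) with ha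
  have ham : a ∈ H2minus 1 := (toeplitz_eq_zero_iff u ξ).1 hker
  have ha0 : a ≠ 0 := by
    rw [← norm_ne_zero_iff, ha, hu.norm_mulOp, norm_ne_zero_iff]
    simpa using hξ
  -- `-q` is the highest frequency occurring in the antianalytic function `uξ`.
  obtain ⟨q, hq, hqmin⟩ : ∃ q : ℕ, fourierCoeff (fun t => a t 0) (-(q : ℤ)) ≠ 0 ∧
      ∀ k : ℤ, -(q : ℤ) < k → fourierCoeff (fun t => a t 0) k = 0 := by
    classical
    have hex : ∃ q : ℕ, fourierCoeff (fun t => a t 0) (-(q : ℤ)) ≠ 0 := by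
      by_contra! hcon
      refine ha0 (eq_zero_of_fourierCoeff fun i k => ?_)
      rw [Subsingleton.elim i 0]
      rcases le_or_gt 0 k with hk | hk
      · exact mem_H2minus_iff.1 ham 0 k hk
      · obtain ⟨q, rfl⟩ : ∃ q : ℕ, k = -(q : ℤ) := ⟨k.natAbs, by omega⟩
        exact hcon q
    refine ⟨Nat.find hex, Nat.find_spec hex, fun k hk => ?_⟩
    rcases le_or_gt 0 k with hk0 | hk0
    · exact mem_H2minus_iff.1 ham 0 k hk0
    · obtain ⟨p, rfl⟩ : ∃ p : ℕ, k = -(p : ℤ) := ⟨k.natAbs, by omega⟩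
      have := Nat.find_min hex (m := p) (by omega)
      rwa [not_not] at this
  have hpair : ∀ f : H2 1, inner ℂ (h : L2 1) (mulOp u f) = 0 := by
    intro f
    have h1 := hh f
    rw [Submodule.coe_inner] at h1
    rw [← toeplitz_add_hankel, inner_add_right, h1,
      (Submodule.mem_orthogonal _ _).1 (hankel u f).2 _ h.2, add_zero]
  have hcoef : ∀ N : ℕ, fourierCoeff (fun t => (h : L2 1) t 0) (N : ℤ) = 0 := by
    intro N
    induction N using Nat.strong_induction_on with
    | _ N ih =>
      -- The shift by `q + N` moves the highest frequency of `uξ` to `N`. In Parseval's sum for the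
      -- pairing with `h`, terms below `N` vanish by analyticity or induction and terms above `N`
      -- vanish by maximality, leaving the coefficient of `h` at `N`.
      have h1 := hpair ⟨shift ((q : ℤ) + N) ξ, shift_mem_H2 (by omega) ξ.2⟩
      rw [mulOp_shift, inner_L2_eq_sum, Fin.sum_univ_one] at h1
      have h2 := hasSum_conj_fourierCoeff_mul (memLp_apply (h : L2 1) 0)
        (memLp_apply (shift ((q : ℤ) + N) a) 0)
      rw [h1] at h2
      have h3 := hasSum_single (f := fun j => star (fourierCoeff (fun t => (h : L2 1) t 0) j) *
        fourierCoeff (fun t => shift ((q : ℤ) + N) a t 0) j) (N : ℤ) fun j hj => ?_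
      · have h4 := h3.unique h2
        rw [fourierCoeff_shift, mul_eq_zero, star_eq_zero,
          show (N : ℤ) - (q + N) = -(q : ℤ) by ring] at h4
        exact h4.resolve_right hq
      · rcases lt_or_ge j 0 with hj0 | hj0
        · rw [mem_H2_iff.1 h.2 0 j hj0, star_zero, zero_mul]
        · rcases lt_or_gt_of_ne hj with hlt | hgt
          · obtain ⟨p, rfl⟩ := Int.eq_ofNat_of_zero_le hj0
            rw [ih p (by omega), star_zero, zero_mul]
          · rw [fourierCoeff_shift, hqmin _ (by omega), mul_zero]
  refine Subtype.ext (eq_zero_of_fourierCoeff fun i k => ?_)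
  rw [Subsingleton.elim i 0]
  rcases lt_or_ge k 0 with hk | hk
  · exact mem_H2_iff.1 h.2 0 k hk
  · obtain ⟨p, rfl⟩ := Int.eq_ofNat_of_zero_le hk
    exact hcoef p

/-- If the kernel were nonzero, Coburn's lemma would make the range dense; being closed, it would be
everything, and the index would be positive. -/
theorem ker_toeplitz_eq_bot {u : Linfty 1 1} (hu : IsUnimodular u)
    (hF : (toeplitz u).IsFredholm) (hind : fredholmIndex (toeplitz u) ≤ 0) :
    (toeplitz u).ker = ⊥ := by
  by_contra hne
  obtain ⟨ξ, hξ, hξ0⟩ := (Submodule.ne_bot_iff _).1 hne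
  have hperp : ((toeplitz u).range)ᗮ = ⊥ := by
    refine (Submodule.eq_bot_iff _).2 fun h hh => ?_
    refine eq_zero_of_orthogonal_range_toeplitz hu hξ0 hξ fun f => ?_
    exact (Submodule.mem_orthogonal' _ _).1 hh _ ⟨f, rfl⟩
  have htop : (toeplitz u).range = ⊤ := by
    have := (Submodule.orthogonal_orthogonal_eq_closure (toeplitz u).range)
    rw [hperp, Submodule.bot_orthogonal_eq_top,
      (hF.isClosed_range).submodule_topologicalClosure_eq] at this
    exact this.symm
  have := hF.finite_ker
  have hpos : 0 < Module.finrank ℂ (toeplitz u).ker := by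
    rw [Module.finrank_pos_iff]
    exact Submodule.nontrivial_iff_ne_bot.2 hne
  have hz : Module.finrank ℂ (H2 1 ⧸ (toeplitz u).range) = 0 := by
    have := Submodule.Quotient.subsingleton_iff.2 htop
    exact Module.finrank_zero_of_subsingleton
  rw [fredholmIndex, hz] at hind
  omega

theorem range_toeplitz_eq_top {u : Linfty 1 1} (hF : (toeplitz u).IsFredholm)
    (hker : (toeplitz u).ker = ⊥) (hind : fredholmIndex (toeplitz u) = 0) :
    (toeplitz u).range = ⊤ := by
  have : Module.Finite ℂ (H2 1 ⧸ (toeplitz u).range) := hF.finite_coker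
  rw [fredholmIndex, hker, finrank_bot] at hind
  have hz : Module.finrank ℂ (H2 1 ⧸ (toeplitz u).range) = 0 := by omega
  exact Submodule.Quotient.subsingleton_iff.1 (Module.finrank_zero_iff.1 hz)

/-! ### Thematic matrix functions -/

/-- These are `V*V = 1` and `VV* = 1` read blockwise, the rows of `V*` being `v*` and `Θᵗ`. -/
theorem IsThematic.blocks {n : ℕ} {v : Linfty n 1} {Θ : Linfty n (n - 1)} (h : IsThematic v Θ) :
    ∀ᵐ t ∂(haarAddCircle : Measure Circ),
      ((v t)ᴴ * v t = 1 ∧ (v t)ᴴ * (Θ t).map star = 0 ∧ (Θ t)ᵀ * v t = 0 ∧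
        (Θ t)ᵀ * (Θ t).map star = 1) ∧ v t * (v t)ᴴ + (Θ t).map star * (Θ t)ᵀ = 1 := by
  filter_upwards [h.unitary] with t ht
  have hΘ : ((Θ t).map star)ᴴ = (Θ t)ᵀ := by
    ext i j
    simp
  obtain ⟨h1, h2⟩ := ht
  rw [thematicMatrix, Matrix.conjTranspose_fromCols_eq_fromRows_conjTranspose, hΘ] at h1 h2
  rw [Matrix.fromRows_mul_fromCols, ← Matrix.fromBlocks_one, Matrix.fromBlocks_inj] at h1
  rw [Matrix.fromCols_mul_fromRows] at h2
  exact ⟨h1, h2⟩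

section Thematic

variable {n : ℕ} {v : Linfty n 1} {Θ : Linfty n (n - 1)}

theorem IsThematic.ctr_v_v (h : IsThematic v Θ) (a : L2 1) :
    mulOp (ctr v) (mulOp v a) = a := by
  refine mulOp_mulOp_of_mul_eq_one ?_ a
  filter_upwards [h.blocks, ctr_ae v] with t h1 h2
  rw [h2, h1.1.1]

theorem IsThematic.transp_Θ_v (h : IsThematic v Θ) (a : L2 1) :
    mulOp (transp Θ) (mulOp v a) = 0 := by
  refine mulOp_mulOp_of_mul_eq_zero ?_ a
  filter_upwards [h.blocks, transp_ae Θ] with t h1 h2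
  rw [h2, h1.1.2.2.1]

theorem IsThematic.decomp (h : IsThematic v Θ) (f : L2 n) :
    mulOp v (mulOp (ctr v) f) + mulOp (conjM Θ) (mulOp (transp Θ) f) = f := by
  refine L2_ext ?_
  filter_upwards [h.blocks, ctr_ae v, transp_ae Θ, conjM_ae Θ, mulOp_ae (ctr v) f,
    mulOp_ae (transp Θ) f, mulOp_ae v (mulOp (ctr v) f),
    mulOp_ae (conjM Θ) (mulOp (transp Θ) f),
    Lp.coeFn_add (mulOp v (mulOp (ctr v) f)) (mulOp (conjM Θ) (mulOp (transp Θ) f))]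
    with t h1 h2 h3 h4 h5 h6 h7 h8 h9
  rw [h9, Pi.add_apply, WithLp.ofLp_add, h7, h8, h5, h6, h2, h3, h4, Matrix.mulVec_mulVec,
    Matrix.mulVec_mulVec, ← Matrix.add_mulVec, h1.2, Matrix.one_mulVec]

theorem IsThematic.norm_sq (h : IsThematic v Θ) (f : L2 n) :
    ‖mulOp (ctr v) f‖ ^ 2 + ‖mulOp (transp Θ) f‖ ^ 2 = ‖f‖ ^ 2 := by
  have h1 : inner ℂ f f = inner ℂ f f := rfl
  nth_rw 1 [← h.decomp f] at h1
  rw [inner_add_left, inner_mulOp v, inner_mulOp (conjM Θ), ctr_conjM,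
    inner_self_eq_norm_sq_to_K, inner_self_eq_norm_sq_to_K, inner_self_eq_norm_sq_to_K] at h1
  exact_mod_cast h1

/-- This and the following identities are conjugates of the block relations. They serve the left
factor: `W* = (w̄ Ξ)` is the entrywise conjugate of the thematic `Wᵗ`. -/
theorem IsThematic.transp_v_conj_v (h : IsThematic v Θ) (a : L2 1) :
    mulOp (transp v) (mulOp (conjM v) a) = a := by
  refine mulOp_mulOp_of_mul_eq_one ?_ a
  filter_upwards [h.blocks, transp_ae v, conjM_ae v] with t h1 h2 h3
  rw [h2, h3]
  have := congrArg Matrix.transpose h1.1.1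
  rwa [Matrix.transpose_mul, Matrix.transpose_one] at this

theorem IsThematic.ctr_Θ_Θ (h : IsThematic v Θ) (g : L2 (n - 1)) :
    mulOp (ctr Θ) (mulOp Θ g) = g := by
  refine mulOp_mulOp_of_mul_eq_one ?_ g
  filter_upwards [h.blocks, ctr_ae Θ] with t h1 h2
  rw [h2]
  have := congrArg Matrix.transpose h1.1.2.2.2
  rwa [Matrix.transpose_mul, Matrix.transpose_one, Matrix.transpose_transpose] at this

theorem IsThematic.ctr_Θ_conj_v (h : IsThematic v Θ) (a : L2 1) :
    mulOp (ctr Θ) (mulOp (conjM v) a) = 0 := by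
  refine mulOp_mulOp_of_mul_eq_zero ?_ a
  filter_upwards [h.blocks, ctr_ae Θ, conjM_ae v] with t h1 h2 h3
  rw [h2, h3]
  have := congrArg Matrix.transpose h1.1.2.1
  rwa [Matrix.transpose_mul, Matrix.transpose_zero] at this

theorem IsThematic.decomp_conj (h : IsThematic v Θ) (f : L2 n) :
    mulOp (conjM v) (mulOp (transp v) f) + mulOp Θ (mulOp (ctr Θ) f) = f := by
  refine L2_ext ?_
  filter_upwards [h.blocks, transp_ae v, ctr_ae Θ, conjM_ae v, mulOp_ae (transp v) f,
    mulOp_ae (ctr Θ) f, mulOp_ae (conjM v) (mulOp (transp v) f),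
    mulOp_ae Θ (mulOp (ctr Θ) f),
    Lp.coeFn_add (mulOp (conjM v) (mulOp (transp v) f)) (mulOp Θ (mulOp (ctr Θ) f))]
    with t h1 h2 h3 h4 h5 h6 h7 h8 h9
  have h10 := congrArg Matrix.transpose h1.2
  rw [Matrix.transpose_add, Matrix.transpose_mul, Matrix.transpose_mul, Matrix.transpose_one,
    Matrix.transpose_transpose] at h10
  rw [h9, Pi.add_apply, WithLp.ofLp_add, h7, h8, h5, h6, h2, h3, h4, Matrix.mulVec_mulVec,
    Matrix.mulVec_mulVec, ← Matrix.add_mulVec]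
  exact (congrArg (· *ᵥ (f t).ofLp) h10).trans (Matrix.one_mulVec _)

theorem IsThematic.norm_sq_conj_add (h : IsThematic v Θ) (a : L2 1) (g : L2 (n - 1)) :
    ‖mulOp (conjM v) a + mulOp Θ g‖ ^ 2 = ‖a‖ ^ 2 + ‖g‖ ^ 2 := by
  have h1 : inner ℂ (mulOp (conjM v) a) (mulOp Θ g) = 0 := by
    rw [inner_mulOp_right, h.ctr_Θ_conj_v, inner_zero_left]
  have h2 := norm_add_sq_eq_norm_sq_add_norm_sq_of_inner_eq_zero _ _ h1
  have h3 : ‖mulOp (conjM v) a‖ = ‖a‖ := by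
    have := inner_mulOp (conjM v) a (mulOp (conjM v) a)
    rw [ctr_conjM, h.transp_v_conj_v, inner_self_eq_norm_sq_to_K,
      inner_self_eq_norm_sq_to_K] at this
    exact (pow_left_inj₀ (norm_nonneg _) (norm_nonneg _) two_ne_zero).1 (by exact_mod_cast this)
  have h4 : ‖mulOp Θ g‖ = ‖g‖ := norm_mulOp_of_isometry h.inner_Θ.2 g
  rw [h3, h4] at h2
  linarith

end Thematic

theorem Factors.mulOp_eq {m n : ℕ} {G : Linfty m n} {w : Linfty m 1} {Ξ : Linfty m (m - 1)}
    {u : Linfty 1 1} {Ψ : Linfty (m - 1) (n - 1)} {v : Linfty n 1} {Θ : Linfty n (n - 1)}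
    (hG : Factors G w Ξ u Ψ v Θ) (f : L2 n) :
    mulOp G f = mulOp (conjM w) (mulOp u (mulOp (ctr v) f)) +
      mulOp Ξ (mulOp Ψ (mulOp (transp Θ) f)) := by
  refine L2_ext ?_
  filter_upwards [hG, mulOp_ae G f, ctr_ae v, transp_ae Θ, conjM_ae w, mulOp_ae (ctr v) f,
    mulOp_ae u (mulOp (ctr v) f), mulOp_ae (conjM w) (mulOp u (mulOp (ctr v) f)),
    mulOp_ae (transp Θ) f, mulOp_ae Ψ (mulOp (transp Θ) f),
    mulOp_ae Ξ (mulOp Ψ (mulOp (transp Θ) f)),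
    Lp.coeFn_add (mulOp (conjM w) (mulOp u (mulOp (ctr v) f)))
      (mulOp Ξ (mulOp Ψ (mulOp (transp Θ) f)))]
    with t h1 h2 h3 h4 h5 h6 h7 h8 h9 h10 h11 h12
  have hΘ : ((Θ t).map star)ᴴ = (Θ t)ᵀ := by
    ext i j
    simp
  have hW : ((thematicMatrix w Ξ t)ᵀ)ᴴ = Matrix.fromCols ((w t).map star) (Ξ t) := by
    ext i (j | j) <;> simp [thematicMatrix]
  rw [hW, thematicMatrix, Matrix.conjTranspose_fromCols_eq_fromRows_conjTranspose, hΘ,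
    Matrix.fromCols_mul_fromBlocks, Matrix.fromCols_mul_fromRows] at h1
  simp only [Matrix.mul_zero, add_zero, zero_add] at h1
  rw [h12, Pi.add_apply, WithLp.ofLp_add, h11, h10, h9, h8, h7, h6, h2, h1, h3, h4, h5]
  simp only [Matrix.mulVec_mulVec, Matrix.add_mulVec, Matrix.mul_assoc]

/-! ### Maximizing vectors and thematic factorizations -/

section Factorization

open Filter Topology

variable {m n : ℕ} {G : Linfty m n} {w : Linfty m 1} {Ξ : Linfty m (m - 1)} {u : Linfty 1 1}
  {Ψ : Linfty (m - 1) (n - 1)} {v : Linfty n 1} {Θ : Linfty n (n - 1)}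

theorem mem_maxVectors {Φ : Linfty m n} (h : ‖hankel Φ‖ = 1) {f : H2 n} :
    f ∈ maxVectors Φ ↔ ‖hankel Φ f‖ = ‖f‖ := by
  rw [maxVectors, mem_maximizing, h, one_mul]

/-- This form needs no prior knowledge of `‖H_Φ‖`, only that it is at most one. -/
theorem mem_maxVectors_of_norm_le {Φ : Linfty m n} (h : ‖Φ‖ ≤ 1) {f : H2 n}
    (hf : ‖hankel Φ f‖ = ‖f‖) : f ∈ maxVectors Φ := by
  rw [maxVectors, mem_maximizing]
  refine le_antisymm ((hankel Φ).le_opNorm f) ?_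
  rw [hf]
  exact mul_le_of_le_one_left (norm_nonneg _) ((norm_hankel_le Φ).trans h)

theorem Factors.norm_sq (hG : Factors G w Ξ u Ψ v Θ) (hW : IsThematic w Ξ) (hu : IsUnimodular u)
    (f : L2 n) :
    ‖mulOp G f‖ ^ 2 = ‖mulOp (ctr v) f‖ ^ 2 + ‖mulOp Ψ (mulOp (transp Θ) f)‖ ^ 2 := by
  rw [hG.mulOp_eq, hW.norm_sq_conj_add, hu.norm_mulOp]

/-- The component along `v` passes through the unimodular `u` without loss of norm, so it cancels
and only `Ψ` contributes to the defect. -/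
theorem Factors.norm_sq_sub (hG : Factors G w Ξ u Ψ v Θ) (hV : IsThematic v Θ)
    (hW : IsThematic w Ξ) (hu : IsUnimodular u) (f : L2 n) :
    ‖f‖ ^ 2 - ‖mulOp G f‖ ^ 2 =
      ‖mulOp (transp Θ) f‖ ^ 2 - ‖mulOp Ψ (mulOp (transp Θ) f)‖ ^ 2 := by
  rw [hG.norm_sq hW hu, ← hV.norm_sq f]
  ring

theorem Factors.norm_mulOp_le (hG : Factors G w Ξ u Ψ v Θ) (hV : IsThematic v Θ)
    (hW : IsThematic w Ξ) (hu : IsUnimodular u) (hΨ : ‖Ψ‖ ≤ 1) (f : L2 n) :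
    ‖mulOp G f‖ ≤ ‖f‖ := by
  have h1 := hG.norm_sq_sub hV hW hu f
  have h2 : ‖mulOp Ψ (mulOp (transp Θ) f)‖ ≤ ‖mulOp (transp Θ) f‖ :=
    (norm_mulOp_apply_le _ _).trans (mul_le_of_le_one_left (norm_nonneg _) hΨ)
  have h3 := pow_le_pow_left₀ (norm_nonneg _) h2 2
  exact (sq_le_sq₀ (norm_nonneg _) (norm_nonneg _)).1 (by linarith)

/-- A maximizing vector of `H_G` annihilated by `Θᵗ` is `ξ v` with `ξ ∈ ker T_u`. -/
theorem Factors.exists_ker_toeplitz (hnorm : ‖hankel G‖ = 1) (hG : Factors G w Ξ u Ψ v Θ)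
    (hV : IsThematic v Θ) (hW : IsThematic w Ξ) (hu : IsUnimodular u) {f : H2 n}
    (hf : f ∈ maxVectors G) (hΘ : mulOp (transp Θ) (f : L2 n) = 0) :
    ∃ ξ : H2 1, toeplitz u ξ = 0 ∧ mulOp v ξ = f := by
  set a := mulOp (ctr v) (f : L2 n)
  have hva : mulOp v a = f := by
    have := hV.decomp (f : L2 n)
    rwa [hΘ, map_zero, add_zero] at this
  -- A priori `v*f` is only in `L²`; co-outerness of `v` makes it analytic.
  have haH : a ∈ H2 1 := hV.coOuter_v.mem_H2_of_mulOp (hva ▸ f.2)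
  have hGf : mulOp G f = mulOp (conjM w) (mulOp u a) := by
    rw [hG.mulOp_eq, hΘ, map_zero, map_zero, add_zero]
  -- With `Θᵗf = 0` the defect of `G` at `f` vanishes whatever `Ψ` is.
  have hle : ‖mulOp G (f : L2 n)‖ ≤ ‖hankel G f‖ := by
    have h1 := hG.norm_sq_sub hV hW hu (f : L2 n)
    rw [hΘ, map_zero, norm_zero, norm_zero, sub_self, sub_eq_zero] at h1
    rw [(mem_maxVectors hnorm).1 hf]
    exact ((pow_left_inj₀ (norm_nonneg _) (norm_nonneg _) two_ne_zero).1 h1).ge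
  have hmem := mulOp_mem_H2minus_of_norm hle
  rw [hGf] at hmem
  exact ⟨⟨a, haH⟩, (toeplitz_eq_zero_iff _ _).2 (hW.coOuter_v.mem_H2minus_of_mulOp hmem), hva⟩

theorem mulOp_transp_mem_H2 (hV : IsThematic v Θ) {f : L2 n} (hf : f ∈ H2 n) :
    mulOp (transp Θ) f ∈ H2 (n - 1) :=
  mulOp_mem_H2 (transp_mem_Hinfty hV.inner_Θ.1) hf

/-- Multiplication by `Θᵗ`, as a map `H²(ℂⁿ) → H²(ℂⁿ⁻¹)`. -/
noncomputable def IsThematic.transpMap (hV : IsThematic v Θ) : H2 n →ₗ[ℂ] H2 (n - 1) :=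
  (mulOp (transp Θ)).toLinearMap.restrict fun _ hf => mulOp_transp_mem_H2 hV hf

theorem IsThematic.coe_transpMap (hV : IsThematic v Θ) (f : H2 n) :
    (hV.transpMap f : L2 (n - 1)) = mulOp (transp Θ) (f : L2 n) := rfl

/-- The chain `‖H_Φ f‖ ≤ ‖Φf‖ ≤ ‖f‖ = ‖H_Φ f‖` collapses to equalities. -/
theorem norm_mulOp_of_norm_hankel {Φ : Linfty m n} {f : H2 n}
    (hle : ‖mulOp Φ (f : L2 n)‖ ≤ ‖(f : L2 n)‖) (hf : ‖hankel Φ f‖ = ‖f‖) :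
    mulOp Φ f ∈ H2minus m ∧ ‖mulOp Φ (f : L2 n)‖ = ‖(f : L2 n)‖ := by
  rw [Submodule.coe_norm] at hf
  have hmem : mulOp Φ f ∈ H2minus m := mulOp_mem_H2minus_of_norm (hle.trans_eq hf.symm)
  exact ⟨hmem, (norm_hankel_of_mem_H2minus hmem).symm.trans hf⟩

/-- `Θᵗ` maps maximizing vectors of `H_G` to maximizing vectors of `H_Ψ`. -/
theorem Factors.norm_hankel_transpMap (hnorm : ‖hankel G‖ = 1)
    (hG : Factors G w Ξ u Ψ v Θ) (hV : IsThematic v Θ) (hW : IsThematic w Ξ) (hu : IsUnimodular u)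
    (hΨ : ‖Ψ‖ ≤ 1) {f : H2 n} (hf : f ∈ maxVectors G) :
    ‖hankel Ψ (hV.transpMap f)‖ = ‖hV.transpMap f‖ := by
  obtain ⟨hmem, hGn⟩ := norm_mulOp_of_norm_hankel (hG.norm_mulOp_le hV hW hu hΨ (f : L2 n))
    ((mem_maxVectors hnorm).1 hf)
  -- `Ξ*` annihilates `w̄` and inverts `Ξ`, so it isolates the `Ψ` component; it also preserves
  -- `H²₋`.
  have hΨG : mulOp Ψ (hV.transpMap f : L2 (n - 1)) = mulOp (ctr Ξ) (mulOp G f) := by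
    rw [hG.mulOp_eq, map_add, hW.ctr_Θ_conj_v, hW.ctr_Θ_Θ, zero_add, hV.coe_transpMap]
  have hmem2 : mulOp Ψ (hV.transpMap f : L2 (n - 1)) ∈ H2minus (m - 1) := by
    rw [hΨG]
    refine mulOp_mem_H2minus ?_ hmem
    rw [ctr_ctr]
    exact hW.inner_Θ.1
  have h1 := hG.norm_sq_sub hV hW hu (f : L2 n)
  rw [hGn, sub_self, ← hV.coe_transpMap] at h1
  rw [norm_hankel_of_mem_H2minus hmem2, Submodule.coe_norm]
  exact (pow_left_inj₀ (norm_nonneg _) (norm_nonneg _) two_ne_zero).1 (by linarith)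

theorem norm_toeplitz_le_of_add {Φ : Linfty m n} {f : H2 n} {s r : L2 m} (hs : s ∈ H2minus m)
    (h : mulOp Φ f = s + r) : ‖toeplitz Φ f‖ ≤ ‖r‖ := by
  rw [Submodule.coe_norm, coe_toeplitz, h, map_add,
    (Submodule.starProjection_apply_eq_zero_iff _).2 hs, zero_add]
  exact (H2 m).norm_starProjection_apply_le r

/-- If `T_u` is onto, then `f ∈ H²` can be corrected by a multiple of `v` so that `T_G f` becomes
controlled by the distance from `ΨΘᵗf` to `Ξ* q`, `q ∈ H²₋`. -/
theorem Factors.exists_norm_toeplitz_le (hG : Factors G w Ξ u Ψ v Θ) (hV : IsThematic v Θ)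
    (hW : IsThematic w Ξ) (hsurj : (toeplitz u).range = ⊤) {f : L2 n} (hf : f ∈ H2 n) {q : L2 m}
    (hq : q ∈ H2minus m) :
    ∃ F : H2 n, mulOp (transp Θ) (F : L2 n) = mulOp (transp Θ) f ∧
      ‖toeplitz G F‖ ≤ ‖mulOp Ψ (mulOp (transp Θ) f) - mulOp (ctr Ξ) q‖ := by
  set a := mulOp (ctr v) f with ha
  set b := mulOp (transp w) q with hb
  -- The first component of `Gf - q` in the frame `(w̄ Ξ)` is `ua - b`. This `ξ` cancels its
  -- analytic part once `f` is replaced by `f - vξ`.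
  obtain ⟨ξ, hξ⟩ := LinearMap.range_eq_top.1 hsurj
    ((H2 1).orthogonalProjectionOnto (mulOp u a - b))
  have hξ' : (toeplitz u ξ : L2 1) = (H2 1).starProjection (mulOp u a - b) :=
    congrArg Subtype.val hξ
  have hc : mulOp u (a - ξ) - b ∈ H2minus 1 := by
    rw [← Submodule.starProjection_apply_eq_zero_iff]
    rw [coe_toeplitz] at hξ'
    rw [map_sub (mulOp u), sub_right_comm, map_sub (H2 1).starProjection, hξ', sub_self]
  have hTF : mulOp (transp Θ) (f - mulOp v ξ) = mulOp (transp Θ) f := by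
    rw [map_sub, hV.transp_Θ_v, sub_zero]
  refine ⟨⟨f - mulOp v ξ, Submodule.sub_mem _ hf (mulOp_mem_H2 hV.inner_v.1 ξ.2)⟩, hTF, ?_⟩
  -- `G(f - vξ)` is this antianalytic function plus `Ξ` times the error, so `T_G` sees only the
  -- second term, and `Ξ` is isometric.
  have hs : mulOp (conjM w) (mulOp u (a - ξ) - b) + q ∈ H2minus m := by
    refine Submodule.add_mem _ (mulOp_mem_H2minus ?_ hc) hq
    rw [ctr_conjM]
    exact transp_mem_Hinfty hW.inner_v.1
  refine (norm_toeplitz_le_of_add hs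
    (r := mulOp Ξ (mulOp Ψ (mulOp (transp Θ) f) - mulOp (ctr Ξ) q)) ?_).trans_eq
    (norm_mulOp_of_isometry hW.inner_Θ.2 _)
  change mulOp G (f - mulOp v ξ) = _
  have hd := hW.decomp_conj q
  rw [hG.mulOp_eq, hTF, map_sub (mulOp (ctr v)), hV.ctr_v_v, ← ha, map_sub (mulOp (conjM w)),
    map_sub (mulOp Ξ)]
  rw [← hb, ← eq_sub_iff_add_eq'] at hd
  rw [hd]
  abel

/-- If `T_u` is invertible, then `Θᵗ` maps the maximizing vectors of `H_G` onto those of `H_Ψ`. -/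
theorem Factors.exists_mem_maxVectors (hess : essNorm (hankel G) < 1) (hnorm : ‖hankel G‖ = 1)
    (hG : Factors G w Ξ u Ψ v Θ) (hV : IsThematic v Θ) (hW : IsThematic w Ξ) (hu : IsUnimodular u)
    (hΨ : ‖Ψ‖ ≤ 1) (hsurj : (toeplitz u).range = ⊤)
    (hinj : ∀ f ∈ maxVectors G, mulOp (transp Θ) (f : L2 n) = 0 → f = 0)
    {g : H2 (n - 1)} (hg : g ∈ maxVectors Ψ) :
    ∃ f ∈ maxVectors G, mulOp (transp Θ) (f : L2 n) = g := by
  -- A nonzero maximizing vector of `H_G` exists because the essential norm is below the norm; its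
  -- image under `Θᵗ` is nonzero and has its norm preserved by `H_Ψ`.
  have hHΨ : ‖hankel Ψ‖ = 1 := by
    obtain ⟨f, hf, hf0⟩ := (Submodule.ne_bot_iff _).1 (maximizing_ne_bot hnorm hess)
    have h0 : 0 < ‖hV.transpMap f‖ :=
      norm_pos_iff.2 fun h => hf0 (hinj f hf (congrArg Subtype.val h))
    refine le_antisymm ((norm_hankel_le Ψ).trans hΨ) ?_
    have h2 := (hankel Ψ).le_opNorm (hV.transpMap f)
    rw [hG.norm_hankel_transpMap hnorm hV hW hu hΨ hf] at h2
    exact (le_mul_iff_one_le_left h0).1 h2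
  obtain ⟨hΨg, hΨn⟩ := norm_mulOp_of_norm_hankel
    ((norm_mulOp_apply_le _ _).trans (mul_le_of_le_one_left (norm_nonneg _) hΨ))
    ((mem_maxVectors hHΨ).1 hg)
  obtain ⟨x, hx, hxlim⟩ := mem_closure_iff_seq_limit.1 (hV.coOuter_Θ.subset_closure g.2)
  have hcl := hW.coOuter_Θ.subset_closure_conjM hΨg
  rw [conjM_transp] at hcl
  obtain ⟨y, hy, hylim⟩ := mem_closure_iff_seq_limit.1 hcl
  have hF : ∀ k, ∃ F : H2 n, mulOp (transp Θ) (F : L2 n) = x k ∧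
      ‖toeplitz G F‖ ≤ ‖mulOp Ψ (x k) - y k‖ := by
    intro k
    obtain ⟨f, hf, hfx⟩ := hx k
    obtain ⟨q, hq, hqy⟩ := hy k
    rw [← hfx, ← hqy]
    exact hG.exists_norm_toeplitz_le hV hW hsurj hf hq
  choose F hFx hFle using hF
  have hT : Tendsto (fun k => ‖toeplitz G (F k)‖) atTop (𝓝 0) := by
    refine squeeze_zero (fun _ => norm_nonneg _) hFle ?_
    have := ((((mulOp Ψ).continuous.tendsto _).comp hxlim).sub hylim).norm
    rwa [sub_self, norm_zero] at this
  refine exists_maximizing_of_tendsto hnorm hess (mulOp (transp Θ) ∘L (H2 n).subtypeL) hinj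
    (f := F) (hxlim.congr fun k => (hFx k).symm) ?_
  -- The defect for `H_G` is the defect for `G`, transferred to `Ψ` at `x k`, plus the Toeplitz
  -- part. The former tends to the defect of `Ψ` at `g`, which is zero.
  have hdef : ∀ k, ‖F k‖ ^ 2 - ‖hankel G (F k)‖ ^ 2 =
      ‖x k‖ ^ 2 - ‖mulOp Ψ (x k)‖ ^ 2 + ‖toeplitz G (F k)‖ ^ 2 := by
    intro k
    have h1 := norm_sq_toeplitz_add_hankel G (F k)
    have h2 := hG.norm_sq_sub hV hW hu (F k : L2 n)
    rw [hFx] at h2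
    rw [← h2, ← h1, Submodule.coe_norm]
    ring
  refine Tendsto.congr (fun k => (hdef k).symm) ?_
  have h3 := ((hxlim.norm.pow 2).sub
    ((((mulOp Ψ).continuous.tendsto _).comp hxlim).norm.pow 2)).add (hT.pow 2)
  rw [hΨn, sub_self, zero_pow two_ne_zero, add_zero] at h3
  exact h3

end Factorization

theorem mainTheorem8 {m n : ℕ} (hm : 2 ≤ m) (hn : 2 ≤ n)
    (G : Linfty m n) (hess : essNorm (hankel G) < 1) (hnorm : ‖hankel G‖ = 1)
    (hbad : IsBadlyApprox G)
    (w : Linfty m 1) (Ξ : Linfty m (m - 1)) (u : Linfty 1 1) (Ψ : Linfty (m - 1) (n - 1))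
    (v : Linfty n 1) (Θ : Linfty n (n - 1))
    (hV : IsThematic v Θ) (hW : IsThematic w Ξ) (hu : IsUnimodular u)
    (hG : Factors G w Ξ u Ψ v Θ) :
    (∀ f ∈ maxVectors G,
      (∀ᵐ t ∂(haarAddCircle : Measure Circ), (Θ t)ᵀ *ᵥ ((f : L2 n) t).ofLp = 0) →
      ∃ ξ ∈ (toeplitz u).ker, ∀ᵐ t ∂(haarAddCircle : Measure Circ),
        ∀ i, (f : L2 n) t i = (ξ : L2 1) t 0 * v t i 0) ∧
    (IsBadlyApprox Ψ → ‖Ψ‖ = 1 → (toeplitz u).IsFredholm → fredholmIndex (toeplitz u) ≤ 0 →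
      Module.rank ℂ (maxVectors G) ≤ Module.rank ℂ (maxVectors Ψ) ∧
      (fredholmIndex (toeplitz u) = 0 →
        Module.rank ℂ (maxVectors G) = Module.rank ℂ (maxVectors Ψ))) := by
  constructor
  · intro f hf hΘ
    have hΘ0 : mulOp (transp Θ) (f : L2 n) = 0 := by
      refine L2_ext ?_
      filter_upwards [hΘ, mulOp_ae (transp Θ) (f : L2 n), transp_ae Θ, Lp.coeFn_zero
        (EuclideanSpace ℂ (Fin (n - 1))) 2 (haarAddCircle : Measure Circ)] with t h1 h2 h3 h4
      rw [h2, h3, h1, h4]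
      rfl
    obtain ⟨ξ, hξ, hvξ⟩ := hG.exists_ker_toeplitz hnorm hV hW hu hf hΘ0
    refine ⟨ξ, hξ, ?_⟩
    filter_upwards [mulOp_apply_ae v (ξ : L2 1)] with t ht i
    rw [← hvξ, ht i, Fin.sum_univ_one, mul_comm]
  · intro _ hΨ hF hind
    have hker := ker_toeplitz_eq_bot hu hF hind
    have hinj : ∀ f ∈ maxVectors G, mulOp (transp Θ) (f : L2 n) = 0 → f = 0 := by
      intro f hf h0
      obtain ⟨ξ, hξ, hvξ⟩ := hG.exists_ker_toeplitz hnorm hV hW hu hf h0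
      have hξ0 : ξ ∈ (toeplitz u).ker := hξ
      rw [hker, Submodule.mem_bot] at hξ0
      rw [hξ0, Submodule.coe_zero, map_zero] at hvξ
      exact Subtype.ext hvξ.symm
    let S : maxVectors G →ₗ[ℂ] maxVectors Ψ :=
      hV.transpMap.restrict fun f hf =>
        mem_maxVectors_of_norm_le hΨ.le (hG.norm_hankel_transpMap hnorm hV hW hu hΨ.le hf)
    have hS : Function.Injective S := by
      rw [injective_iff_map_eq_zero]
      intro f hf
      exact Subtype.ext (hinj f.1 f.2 (congrArg Subtype.val (congrArg Subtype.val hf)))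
    refine ⟨LinearMap.rank_le_of_injective S hS, fun hind0 => ?_⟩
    refine (LinearEquiv.ofBijective S ⟨hS, fun g => ?_⟩).rank_eq
    obtain ⟨f, hf, hfg⟩ := hG.exists_mem_maxVectors hess hnorm hV hW hu hΨ.le
      (range_toeplitz_eq_top hF hker hind0) hinj g.2
    exact ⟨⟨f, hf⟩, Subtype.ext (Subtype.ext hfg)⟩
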